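/- Let $E=(E^0,E^1,r,s)$ be a finite directed graph without sinks in which every loop has an exit: for every path $\mu=(\mu_1,\dots,\mu_m)$, $m\ge 1$, with $s(\mu)=r(\mu)$ there is a $j$ such that $s(\mu_j)$ emits at least two distinct edges. Let $C^*(E)$ be its graph $C^*$-algebra, i.e. the universal $C^*$-algebra generated by mutually orthogonal projections $P_v$, $v\in E^0$ (with $\sum_v P_v=1$), and elements $S_e$, $e\in E^1$, such that $S_e^*S_e=P_{r(e)}$, $S_e^*S_f=0$ for $e\ne f$, $S_eS_e^*\le P_{s(e)}$, and $P_v=\sum_{s(e)=v}S_eS_e^*$ for every $v$ that emits an edge. Let $E^n$ be the set of paths of length $n$ ($E^0$ being the set of vertices, viewed as paths of length $0$), where consecutive edges of a path satisfy $r(\mu_j)=s(\mu_{j+1})$, and put $S_\mu=S_{\mu_1}\cdots S_{\mu_n}$ (and $S_v=P_v$). Let $k\ge 1$ and let $u\in C^*(E)$ be a unitary that commutes with all $P_v$ and is a finite sum of elements $S_\alpha S_\beta^*$ with $\alpha,\beta\in E^k$. Let $\lambda_u$ be the $*$-endomorphism of $C^*(E)$ with $\lambda_u(S_e)=uS_e$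 and $\lambda_u(P_v)=P_v$. Then there is a unique permutation $\sigma$ of $E^k$, preserving the source and the range of every path, such that $u=\sum_{\alpha\in E^k}S_{\sigma(\alpha)}S_\alpha^*$. Moreover, $\lambda_u$ is an automorphism of $C^*(E)$ if and only if both of the following conditions hold. (1) For $e\in E^1$ and a path $\alpha\in E^{k-1}$ with source $r(e)$ let $f_e^u(\alpha)\in E^{k-1}$ be the path $\beta$ (with source $s(e)$) such that $\sigma(e,\alpha)=(\beta,g)$ for some $g\in E^1$. There is a partial order $\le$ on the set of all pairs $(\alpha,\beta)$ of paths in $E^{k-1}$ with a common source such that * the minimal elements are exactly the diagonal elements $(\alpha,\alpha)$ and the pairs whose common source does not belong to $r(E^1)$; * $(f_e^u(\alpha),f_e^u(\beta))<(\alpha,\beta)$ for all $e\in E^1$ and all $\alpha\ne\beta$ in $E^{k-1}$ with source $r(e)$. (2) Let $\Psi_u=\{(\alpha,\beta)\in E^{k-1}\times E^{k-1}:\alpha\ne\beta\}$. For $e,g\in E^1$ let $f_{e,g}^u$ be the partially defined map on $\Psi_u$ whose domain $D(f_{e,g}^u)$ consists of the $(\alpha,\beta)\in\Psi_u$ with $s(\alpha)=r(e)$,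 $s(\beta)=r(g)$ for which there are $h\in E^1$ and $\gamma,\delta\in E^{k-1}$ with $\sigma(e,\alpha)=(\gamma,h)$ and $\sigma(g,\beta)=(\delta,h)$; then $\gamma\neq\delta$ and $f_{e,g}^u(\alpha,\beta)=(\gamma,\delta)$. Let $\Delta_u=\bigcup_{e,g}D(f_{e,g}^u)$. There is a partial order $\le$ on $\Psi_u$ such that * the set of minimal elements is $\Psi_u\setminus\Delta_u$; * $f_{e,g}^u(\alpha,\beta)<(\alpha,\beta)$ for all $e,g\in E^1$ and all $(\alpha,\beta)\in D(f_{e,g}^u)$. -/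

import Mathlib

noncomputable section

/-! ## Free `*`-algebras -/

/-- The free unital complex `*`-algebra on a set `G`: complex linear combinations of words in the
letters `(g, false)`, standing for `g`, and `(g, true)`, standing for `g*`. -/
def FreeStarAlg (G : Type*) : Type _ := MonoidAlgebra ℂ (FreeMonoid (G × Bool))

namespace FreeStarAlg

variable {G : Type*}

instance : Ring (FreeStarAlg G) :=
  inferInstanceAs (Ring (MonoidAlgebra ℂ (FreeMonoid (G × Bool))))

instance : Algebra ℂ (FreeStarAlg G) :=
  inferInstanceAs (Algebra ℂ (MonoidAlgebra ℂ (FreeMonoid (G × Bool))))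

/-- The monomial `c • w`. -/
def mono (w : FreeMonoid (G × Bool)) (c : ℂ) : FreeStarAlg G := MonoidAlgebra.single w c

/-- The generator `g`. -/
def gen (g : G) : FreeStarAlg G := mono (FreeMonoid.of (g, false)) 1

/-- The adjoint of a word: reverse it and exchange the letters `g` and `g*`. -/
def wordStar (w : FreeMonoid (G × Bool)) : FreeMonoid (G × Bool) :=
  star (FreeMonoid.map (fun p => (p.1, !p.2)) w)

theorem wordStar_mul (a b : FreeMonoid (G × Bool)) :
    wordStar (a * b) = wordStar b * wordStar a := by
  simp [wordStar]

theorem wordStar_wordStar (a : FreeMonoid (G × Bool)) : wordStar (wordStar a) = a := by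
  induction a using FreeMonoid.inductionOn with
  | one => simp [wordStar]
  | of x => simp [wordStar]
  | mul x y hx hy => rw [wordStar_mul, wordStar_mul, hx, hy]

@[elab_as_elim]
theorem induction_mono {motive : FreeStarAlg G → Prop} (x : FreeStarAlg G) (zero : motive 0)
    (add : ∀ x y, motive x → motive y → motive (x + y)) (mono : ∀ w c, motive (mono w c)) :
    motive x :=
  MonoidAlgebra.induction_linear (motive := motive) x zero add mono

theorem mono_mul_mono (v w : FreeMonoid (G × Bool)) (c d : ℂ) :
    mono v c * mono w d = mono (v * w) (c * d) :=
  MonoidAlgebra.single_mul_single v w c d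

theorem mono_one : mono (1 : FreeMonoid (G × Bool)) 1 = (1 : FreeStarAlg G) := rfl

theorem smul_mono (c d : ℂ) (w : FreeMonoid (G × Bool)) : c • mono w d = mono w (c * d) :=
  MonoidAlgebra.smul_single c w d

/-- The adjoint on the free `*`-algebra: conjugate-linear, and `wordStar` on words. -/
def starAux : FreeStarAlg G →+ FreeStarAlg G :=
  (Finsupp.liftAddHom fun w =>
    ((MonoidAlgebra.singleAddHom (wordStar w)).comp (starRingEnd ℂ).toAddMonoidHom :
      ℂ →+ MonoidAlgebra ℂ (FreeMonoid (G × Bool)))).comp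
    (MonoidAlgebra.coeffAddEquiv (R := ℂ) (M := FreeMonoid (G × Bool))).toAddMonoidHom

theorem starAux_mono (w : FreeMonoid (G × Bool)) (c : ℂ) :
    starAux (mono w c) = mono (wordStar w) (starRingEnd ℂ c) := by
  change (Finsupp.single w c).sum (fun w c =>
    MonoidAlgebra.single (wordStar w) (starRingEnd ℂ c)) = MonoidAlgebra.single _ _
  exact Finsupp.sum_single_index (by simp)

instance : StarRing (FreeStarAlg G) where
  star := starAux
  star_involutive x := by
    induction x using induction_mono with
    | zero => simp
    | add x y hx hy => simp [hx, hy]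
    | mono w c => simp [starAux_mono, wordStar_wordStar]
  star_mul x y := by
    change starAux (x * y) = starAux y * starAux x
    induction x using induction_mono with
    | zero => simp
    | add x y hx hy => simp [hx, hy, add_mul, mul_add]
    | mono w c =>
      induction y using induction_mono with
      | zero => simp
      | add x y hx hy => simp [hx, hy, add_mul, mul_add]
      | mono v d => simp [starAux_mono, mono_mul_mono, wordStar_mul, mul_comm]
  star_add := map_add starAux

theorem star_mono (w : FreeMonoid (G × Bool)) (c : ℂ) :
    star (mono w c) = mono (wordStar w) (starRingEnd ℂ c) := starAux_mono w c

theorem star_gen (g : G) : star (gen g) = mono (FreeMonoid.of (g, true)) 1 := by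
  simp [gen, star_mono, wordStar]

instance : StarModule ℂ (FreeStarAlg G) where
  star_smul c x := by
    induction x using induction_mono with
    | zero => simp
    | add x y hx hy => simp only [smul_add, star_add, hx, hy]
    | mono w d => simp [smul_mono, star_mono]

/-- Evaluation of `*`-polynomials at a family of elements of a `*`-algebra. -/
def eval {B : Type*} [Ring B] [StarRing B] [Algebra ℂ B] [StarModule ℂ B] (x : G → B) :
    FreeStarAlg G →⋆ₐ[ℂ] B where
  __ := (MonoidAlgebra.lift ℂ B (FreeMonoid (G × Bool))
    (FreeMonoid.lift fun p => if p.2 then star (x p.1) else x p.1) :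
      MonoidAlgebra ℂ (FreeMonoid (G × Bool)) →ₐ[ℂ] B)
  map_star' a := by
    set f : FreeMonoid (G × Bool) →* B :=
      FreeMonoid.lift fun p => if p.2 then star (x p.1) else x p.1 with hf
    set F : FreeStarAlg G →ₐ[ℂ] B := MonoidAlgebra.lift ℂ B (FreeMonoid (G × Bool)) f with hF
    have hmono : ∀ w c, F (mono w c) = c • f w := fun w c => MonoidAlgebra.lift_single f w c
    have hw : ∀ w, f (wordStar w) = star (f w) := by
      intro w
      induction w using FreeMonoid.inductionOn with
      | one => simp [wordStar]
      | of p => rcases p with ⟨g, b⟩; cases b <;> simp [wordStar, hf]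
      | mul v w hv hw => rw [wordStar_mul, map_mul, map_mul, star_mul, hv, hw]
    change F (star a) = star (F a)
    induction a using induction_mono with
    | zero => simp
    | add x y hx hy => simp only [star_add, map_add, hx, hy]
    | mono w c => rw [star_mono, hmono, hmono, hw, star_smul]; rfl

theorem eval_gen {B : Type*} [Ring B] [StarRing B] [Algebra ℂ B] [StarModule ℂ B] (x : G → B)
    (g : G) : eval x (gen g) = x g := by
  have : eval x (gen g) = (1 : ℂ) • (FreeMonoid.lift fun p : G × Bool =>
      if p.2 then star (x p.1) else x p.1) (FreeMonoid.of (g, false)) :=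
    MonoidAlgebra.lift_single _ _ _
  simpa using this

/-- `*`-homomorphisms on the free `*`-algebra are determined by the generators. -/
theorem hom_ext {B : Type*} [Ring B] [StarRing B] [Algebra ℂ B] [StarModule ℂ B]
    {φ ψ : FreeStarAlg G →⋆ₐ[ℂ] B} (h : ∀ g, φ (gen g) = ψ (gen g)) : φ = ψ := by
  have hw : ∀ w : FreeMonoid (G × Bool), φ (mono w 1) = ψ (mono w 1) := by
    intro w
    induction w using FreeMonoid.inductionOn with
    | one => rw [mono_one, map_one, map_one]
    | of y =>
      rcases y with ⟨g, b⟩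
      cases b
      · exact h g
      · rw [← star_gen, map_star, map_star, h]
    | mul v w hv hw =>
      have h : mono (v * w) 1 = mono v 1 * mono w 1 := by rw [mono_mul_mono, mul_one]
      rw [h, map_mul, map_mul, hv, hw]
  refine StarAlgHom.ext fun x => ?_
  induction x using induction_mono with
  | zero => rw [map_zero, map_zero]
  | add x y hx hy => rw [map_add, map_add, hx, hy]
  | mono w c =>
    have h : mono w c = c • mono w 1 := by rw [smul_mono, mul_one]
    rw [h, map_smul, map_smul, hw]

end FreeStarAlg

/-! ## Directed graphs and paths -/

/-- A directed graph with vertex set `V` and edge set `Ed`; `s` and `r` are the source and range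
maps. Parallel edges and edges with equal source and range are allowed. -/
structure DirGraph (V Ed : Type*) where
  s : Ed → V
  r : Ed → V

namespace DirGraph

variable {V Ed : Type*} (E : DirGraph V Ed)

/-- `l` is the edge sequence of a path starting at the vertex `v`. -/
def IsWalk : V → List Ed → Prop
  | _, [] => True
  | v, e :: l => E.s e = v ∧ IsWalk (E.r e) l

/-- The vertex reached from `v` along the edge sequence `l`. -/
def endpoint : V → List Ed → V
  | v, [] => v
  | _, e :: l => endpoint (E.r e) l

/-- `E^n`, the set of paths of length `n`: for `n ≥ 1` these are the sequences of `n` composable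
edges (`src` is then determined by the edges), for `n = 0` they are the vertices. -/
@[ext]
structure Path (n : ℕ) where
  src : V
  edges : List Ed
  length_eq : edges.length = n
  walk : E.IsWalk src edges

instance [Finite V] [Finite Ed] (n : ℕ) : Finite (E.Path n) :=
  Finite.of_injective
    (fun μ : E.Path n => ((μ.src, ⟨μ.edges, μ.length_eq⟩) : V × List.Vector Ed n))
    (fun μ ν h => by
      have h1 := congrArg Prod.fst h
      have h2 := congrArg (fun x => x.2.1) h
      exact Path.ext h1 h2)

instance [Finite V] [Finite Ed] (n : ℕ) : Fintype (E.Path n) := Fintype.ofFinite _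

variable {E}

theorem IsWalk.of_append {v : V} {l l' : List Ed} (h : E.IsWalk v (l ++ l')) : E.IsWalk v l := by
  induction l generalizing v with
  | nil => trivial
  | cons e l ih => exact ⟨h.1, ih h.2⟩

namespace Path

variable {n : ℕ}

/-- The range of a path. -/
def rng (μ : E.Path n) : V := E.endpoint μ.src μ.edges

/-- The path `(e, α)`. -/
def cons (e : Ed) (α : E.Path n) (h : α.src = E.r e) : E.Path (n + 1) where
  src := E.s e
  edges := e :: α.edges
  length_eq := by simp [α.length_eq]
  walk := ⟨rfl, h ▸ α.walk⟩

theorem edges_ne_nil (μ : E.Path (n + 1)) : μ.edges ≠ [] :=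
  List.ne_nil_of_length_eq_add_one μ.length_eq

/-- The path `β` of length `n` such that `μ = (β, g)` with `g` an edge. -/
def init (μ : E.Path (n + 1)) : E.Path n where
  src := μ.src
  edges := μ.edges.dropLast
  length_eq := by simp [μ.length_eq]
  walk := IsWalk.of_append (l' := [μ.edges.getLast μ.edges_ne_nil])
    (by rw [List.dropLast_append_getLast]; exact μ.walk)

/-- The edge `g` such that `μ = (β, g)` with `β` a path of length `n`. -/
def last (μ : E.Path (n + 1)) : Ed := μ.edges.getLast μ.edges_ne_nil

theorem ext_init_last {μ ν : E.Path (n + 1)} (h : μ.init = ν.init) (h' : μ.last = ν.last) :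
    μ = ν := by
  have h1 : μ.init.src = ν.init.src := by rw [h]
  have h2 : μ.init.edges = ν.init.edges := by rw [h]
  change μ.edges.dropLast = ν.edges.dropLast at h2
  refine Path.ext h1 ?_
  rw [← List.dropLast_append_getLast μ.edges_ne_nil, ← List.dropLast_append_getLast ν.edges_ne_nil,
    h2]
  simp only [last] at h'
  rw [h']

end Path

variable (E)

/-- There are no sinks: every vertex emits an edge. -/
def NoSinks : Prop := ∀ v, ∃ e, E.s e = v

/-- Every loop has an exit: for every path `μ` of length at least `1` with equal source and range,
the source of one of the edges of `μ` emits at least two distinct edges. -/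
def EveryLoopHasExit : Prop :=
  ∀ (n : ℕ) (μ : E.Path n), 1 ≤ n → μ.src = μ.rng →
    ∃ e ∈ μ.edges, ∃ f g, f ≠ g ∧ E.s f = E.s e ∧ E.s g = E.s e

/-! ## Cuntz-Krieger families and the graph `C*`-algebra -/

section CStar

variable [Fintype V] [Fintype Ed]

open Classical in
/-- The defining relations of the `C*`-algebra of a finite graph, for a family of elements `P v`,
`S e` of a unital `*`-algebra, where equality is read as the relation `R`. The `P v` are mutually
orthogonal projections, and (since `E` has finitely many vertices) their sum is the unit.
The relation `edge_le` says that `S e * star (S e) ≤ P (s e)` as projections. -/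
structure CKRelations {B : Type*} [Ring B] [StarRing B] (R : B → B → Prop)
    (P : V → B) (S : Ed → B) : Prop where
  vertex_star : ∀ v, R (star (P v)) (P v)
  vertex_idem : ∀ v, R (P v * P v) (P v)
  vertex_orth : ∀ v w, v ≠ w → R (P v * P w) 0
  vertex_sum : R (∑ v, P v) 1
  edge_initial : ∀ e, R (star (S e) * S e) (P (E.r e))
  edge_orth : ∀ e f, e ≠ f → R (star (S e) * S f) 0
  edge_le : ∀ e, R (P (E.s e) * (S e * star (S e))) (S e * star (S e))
  edge_sum : ∀ v, (∃ e, E.s e = v) → R (P v) (∑ e with E.s e = v, S e * star (S e))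

/-- `P`, `S` is a Cuntz-Krieger `E`-family. -/
abbrev IsCKFamily {B : Type*} [Ring B] [StarRing B] (P : V → B) (S : Ed → B) : Prop :=
  E.CKRelations (· = ·) P S

variable {E} in
theorem CKRelations.map {B C : Type*} [Ring B] [StarRing B] [Ring C] [StarRing C]
    {R : B → B → Prop} {R' : C → C → Prop} {P : V → B} {S : Ed → B} (h : E.CKRelations R P S)
    {F : Type*} [FunLike F B C] [RingHomClass F B C] [StarHomClass F B C] (φ : F)
    (hR : ∀ x y, R x y → R' (φ x) (φ y)) :
    E.CKRelations R' (fun v => φ (P v)) (fun e => φ (S e)) where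
  vertex_star v := by simpa [map_star] using hR _ _ (h.vertex_star v)
  vertex_idem v := by simpa using hR _ _ (h.vertex_idem v)
  vertex_orth v w hvw := by simpa using hR _ _ (h.vertex_orth v w hvw)
  vertex_sum := by simpa using hR _ _ h.vertex_sum
  edge_initial e := by simpa [map_star] using hR _ _ (h.edge_initial e)
  edge_orth e f hef := by simpa [map_star] using hR _ _ (h.edge_orth e f hef)
  edge_le e := by simpa [map_star] using hR _ _ (h.edge_le e)
  edge_sum v hv := by simpa [map_star] using hR _ _ (h.edge_sum v hv)

/-- The free unital `*`-algebra on symbols for the vertices and the edges. It carries below the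
universal `C*`-seminorm for the defining relations. -/
def PreAlg (_E : DirGraph V Ed) : Type _ := FreeStarAlg (V ⊕ Ed)

namespace PreAlg

instance : Ring E.PreAlg := inferInstanceAs (Ring (FreeStarAlg (V ⊕ Ed)))
instance : Algebra ℂ E.PreAlg := inferInstanceAs (Algebra ℂ (FreeStarAlg (V ⊕ Ed)))
instance : StarRing E.PreAlg := inferInstanceAs (StarRing (FreeStarAlg (V ⊕ Ed)))
instance : StarModule ℂ E.PreAlg := inferInstanceAs (StarModule ℂ (FreeStarAlg (V ⊕ Ed)))

/-- The symbol of a vertex. -/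
def vert (v : V) : E.PreAlg := FreeStarAlg.gen (Sum.inl v)

/-- The symbol of an edge. -/
def edge (e : Ed) : E.PreAlg := FreeStarAlg.gen (Sum.inr e)

variable {E}

/-- `p` is a `C*`-seminorm for which the defining relations hold modulo `p`-null elements. -/
structure Admissible (p : E.PreAlg → ℝ) : Prop where
  add_le : ∀ x y, p (x + y) ≤ p x + p y
  smul_eq : ∀ (c : ℂ) x, p (c • x) = ‖c‖ * p x
  mul_le : ∀ x y, p (x * y) ≤ p x * p y
  star_mul_self : ∀ x, p (star x * x) = p x * p x
  relations : E.CKRelations (fun x y => p (x - y) = 0) (vert E) (edge E)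

namespace Admissible

variable {p : E.PreAlg → ℝ}

theorem map_zero (hp : Admissible p) : p 0 = 0 := by simpa using hp.smul_eq 0 0

theorem map_neg (hp : Admissible p) (x : E.PreAlg) : p (-x) = p x := by simpa using hp.smul_eq (-1) x

theorem nonneg (hp : Admissible p) (x : E.PreAlg) : 0 ≤ p x := by
  have := hp.add_le x (-x)
  rw [add_neg_cancel, hp.map_zero, hp.map_neg] at this
  linarith

theorem le_star (hp : Admissible p) (x : E.PreAlg) : p x ≤ p (star x) := by
  by_contra! h
  have h1 := hp.mul_le (star x) x
  rw [hp.star_mul_self] at h1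
  nlinarith [hp.nonneg (star x)]

theorem map_star (hp : Admissible p) (x : E.PreAlg) : p (star x) = p x :=
  le_antisymm (by simpa using hp.le_star (star x)) (hp.le_star x)

theorem le_of_sub (hp : Admissible p) {x y : E.PreAlg} (h : p (x - y) = 0) : p x ≤ p y := by
  have := hp.add_le (x - y) y
  rwa [sub_add_cancel, h, zero_add] at this

theorem map_one_le (hp : Admissible p) : p 1 ≤ 1 := by
  have := hp.star_mul_self 1
  simp only [star_one, mul_one] at this
  nlinarith [sq_nonneg (p 1 - 1)]

theorem vert_le (hp : Admissible p) (v : V) : p (vert E v) ≤ 1 := by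
  have h0 := hp.le_of_sub (hp.relations.vertex_idem v)
  have h1 : p (vert E v * vert E v) = p (vert E v) * p (vert E v) := by
    have h2 : p (star (vert E v) * vert E v - vert E v * vert E v) = 0 := by
      refine le_antisymm ?_ (hp.nonneg _)
      rw [← sub_mul]
      refine (hp.mul_le _ _).trans ?_
      rw [hp.relations.vertex_star v, zero_mul]
    rw [← hp.star_mul_self]
    refine le_antisymm ?_ (hp.le_of_sub h2)
    refine hp.le_of_sub ?_
    rw [← hp.map_neg, neg_sub, h2]
  rw [h1] at h0
  nlinarith [hp.nonneg (vert E v)]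

theorem edge_le (hp : Admissible p) (e : Ed) : p (edge E e) ≤ 1 := by
  have h0 := (hp.le_of_sub (hp.relations.edge_initial e)).trans (hp.vert_le _)
  rw [hp.star_mul_self] at h0
  nlinarith [hp.nonneg (edge E e)]

end Admissible

theorem admissible_zero : Admissible (fun _ : E.PreAlg => (0 : ℝ)) where
  add_le := by simp
  smul_eq := by simp
  mul_le := by simp
  star_mul_self := by simp
  relations := by constructor <;> simp

theorem bddAbove (x : E.PreAlg) :
    BddAbove (Set.range fun p : {p : E.PreAlg → ℝ // Admissible p} => p.1 x) := by
  suffices h : ∃ C : ℝ, ∀ p : E.PreAlg → ℝ, Admissible p → p x ≤ C by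
    obtain ⟨C, hC⟩ := h
    exact ⟨C, by rintro _ ⟨p, rfl⟩; exact hC p.1 p.2⟩
  have hw : ∀ w : FreeMonoid ((V ⊕ Ed) × Bool), ∀ p : E.PreAlg → ℝ, Admissible p →
      p (FreeStarAlg.mono w 1) ≤ 1 := by
    intro w p hp
    induction w using FreeMonoid.inductionOn with
    | one => exact hp.map_one_le
    | of y =>
      have key : ∀ g : V ⊕ Ed, p (FreeStarAlg.gen g) ≤ 1 := by
        rintro (v | e)
        · exact hp.vert_le v
        · exact hp.edge_le e
      rcases y with ⟨g, b⟩
      cases b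
      · exact key g
      · rw [← FreeStarAlg.star_gen]
        exact (hp.map_star (FreeStarAlg.gen g)).trans_le (key g)
    | mul v w hv hw =>
      have h := hp.mul_le (FreeStarAlg.mono v 1) (FreeStarAlg.mono w 1)
      have h' : (FreeStarAlg.mono (v * w) 1 : E.PreAlg) =
          (FreeStarAlg.mono v 1 : E.PreAlg) * (FreeStarAlg.mono w 1 : E.PreAlg) := by
        have := FreeStarAlg.mono_mul_mono v w 1 1
        rw [mul_one] at this
        exact this.symm
      rw [h']
      exact h.trans (mul_le_one₀ hv (hp.nonneg _) hw)
  refine FreeStarAlg.induction_mono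
    (motive := fun x : FreeStarAlg (V ⊕ Ed) => ∃ C : ℝ, ∀ p : E.PreAlg → ℝ, Admissible p → p x ≤ C)
    x ⟨0, fun p hp => hp.map_zero.le⟩ ?_ ?_
  · rintro x y ⟨C, hC⟩ ⟨D, hD⟩
    exact ⟨C + D, fun p hp => (hp.add_le x y).trans (add_le_add (hC p hp) (hD p hp))⟩
  · intro w c
    refine ⟨‖c‖, fun p hp => ?_⟩
    have h : (FreeStarAlg.mono w c : FreeStarAlg (V ⊕ Ed)) = c • FreeStarAlg.mono w 1 := by
      rw [FreeStarAlg.smul_mono, mul_one]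
    rw [h]
    refine (hp.smul_eq c (FreeStarAlg.mono w 1)).trans_le ?_
    exact mul_le_of_le_one_right (norm_nonneg c) (hw w p hp)

/-- The universal `C*`-seminorm: the supremum of all `C*`-seminorms for which the defining
relations hold. -/
def univNorm (x : E.PreAlg) : ℝ := ⨆ p : {p : E.PreAlg → ℝ // Admissible p}, p.1 x

theorem le_univNorm {p : E.PreAlg → ℝ} (hp : Admissible p) (x : E.PreAlg) : p x ≤ univNorm x :=
  le_ciSup (f := fun p : {p : E.PreAlg → ℝ // Admissible p} => p.1 x) (bddAbove x) ⟨p, hp⟩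

theorem univNorm_le {x : E.PreAlg} {C : ℝ} (h : ∀ p : E.PreAlg → ℝ, Admissible p → p x ≤ C) :
    univNorm x ≤ C :=
  haveI : Nonempty {p : E.PreAlg → ℝ // Admissible p} := ⟨⟨_, admissible_zero⟩⟩
  ciSup_le fun p => h p.1 p.2

theorem univNorm_nonneg (x : E.PreAlg) : 0 ≤ univNorm x := le_univNorm admissible_zero x

theorem univNorm_eq_zero {x : E.PreAlg} (h : ∀ p : E.PreAlg → ℝ, Admissible p → p x = 0) :
    univNorm x = 0 :=
  le_antisymm (univNorm_le fun p hp => (h p hp).le) (univNorm_nonneg x)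

theorem admissible_univNorm : Admissible (univNorm : E.PreAlg → ℝ) where
  add_le x y := univNorm_le fun p hp =>
    (hp.add_le x y).trans (add_le_add (le_univNorm hp x) (le_univNorm hp y))
  smul_eq c x := by
    refine le_antisymm (univNorm_le fun p hp => ?_) ?_
    · rw [hp.smul_eq]
      exact mul_le_mul_of_nonneg_left (le_univNorm hp x) (norm_nonneg c)
    · rcases eq_or_ne c 0 with rfl | hc
      · simpa using univNorm_nonneg _
      · rw [← le_div_iff₀' (norm_pos_iff.2 hc)]
        refine univNorm_le fun p hp => ?_
        rw [le_div_iff₀' (norm_pos_iff.2 hc), ← hp.smul_eq]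
        exact le_univNorm hp _
  mul_le x y := univNorm_le fun p hp => (hp.mul_le x y).trans
    (mul_le_mul (le_univNorm hp x) (le_univNorm hp y) (hp.nonneg y) (univNorm_nonneg x))
  star_mul_self x := by
    refine le_antisymm (univNorm_le fun p hp => ?_) ?_
    · rw [hp.star_mul_self]
      exact mul_self_le_mul_self (hp.nonneg x) (le_univNorm hp x)
    · have h : univNorm x ≤ √(univNorm (star x * x)) := univNorm_le fun p hp =>
        Real.le_sqrt_of_sq_le (by rw [sq, ← hp.star_mul_self]; exact le_univNorm hp _)
      calc univNorm x * univNorm x ≤ √(univNorm (star x * x)) * √(univNorm (star x * x)) :=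
            mul_self_le_mul_self (univNorm_nonneg x) h
        _ = univNorm (star x * x) := Real.mul_self_sqrt (univNorm_nonneg _)
  relations :=
    { vertex_star := fun v => univNorm_eq_zero fun _ hp => hp.relations.vertex_star v
      vertex_idem := fun v => univNorm_eq_zero fun _ hp => hp.relations.vertex_idem v
      vertex_orth := fun v w h => univNorm_eq_zero fun _ hp => hp.relations.vertex_orth v w h
      vertex_sum := univNorm_eq_zero fun _ hp => hp.relations.vertex_sum
      edge_initial := fun e => univNorm_eq_zero fun _ hp => hp.relations.edge_initial e
      edge_orth := fun e f h => univNorm_eq_zero fun _ hp => hp.relations.edge_orth e f h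
      edge_le := fun e => univNorm_eq_zero fun _ hp => hp.relations.edge_le e
      edge_sum := fun v h => univNorm_eq_zero fun _ hp => hp.relations.edge_sum v h }

instance : SeminormedRing E.PreAlg where
  __ := (inferInstance : Ring E.PreAlg)
  __ := AddGroupSeminorm.toSeminormedAddCommGroup
    { toFun := univNorm
      map_zero' := admissible_univNorm.map_zero
      add_le' := admissible_univNorm.add_le
      neg' := admissible_univNorm.map_neg : AddGroupSeminorm E.PreAlg }
  norm_mul_le := admissible_univNorm.mul_le

theorem norm_def (x : E.PreAlg) : ‖x‖ = univNorm x := rfl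

instance : NormedSpace ℂ E.PreAlg where
  norm_smul_le c x := (admissible_univNorm.smul_eq c x).le

instance : NormedStarGroup E.PreAlg where
  norm_star_le x := (admissible_univNorm.map_star x).le

end PreAlg

/-- The graph `C*`-algebra `C*(E)` of a finite graph: the completion of the free `*`-algebra on the
vertices and edges in the universal `C*`-seminorm for the defining relations (elements of
seminorm zero being identified with zero). -/
def CStar : Type _ := UniformSpace.Completion E.PreAlg

namespace CStar

open UniformSpace

instance : NormedRing E.CStar := inferInstanceAs (NormedRing (Completion E.PreAlg))
instance : CompleteSpace E.CStar := inferInstanceAs (CompleteSpace (Completion E.PreAlg))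
instance : NormedSpace ℂ E.CStar := inferInstanceAs (NormedSpace ℂ (Completion E.PreAlg))
instance : Algebra ℂ E.CStar := inferInstanceAs (Algebra ℂ (Completion E.PreAlg))
instance : NormedAlgebra ℂ E.CStar where
  norm_smul_le := norm_smul_le

/-- The canonical map from `*`-polynomials to `C*(E)`. -/
def ofPoly : E.PreAlg →ₐ[ℂ] E.CStar where
  __ := (Completion.coeRingHom : E.PreAlg →+* Completion E.PreAlg)
  commutes' _ := rfl

variable {E}

theorem denseRange_ofPoly : DenseRange (ofPoly E) := Completion.denseRange_coe (α := E.PreAlg)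

theorem norm_ofPoly (x : E.PreAlg) : ‖ofPoly E x‖ = PreAlg.univNorm x := Completion.norm_coe x

theorem continuous_ofPoly : Continuous (ofPoly E) := Completion.continuous_coe E.PreAlg

instance : Star E.CStar where
  star := Completion.map (star : E.PreAlg → E.PreAlg)

theorem star_ofPoly (x : E.PreAlg) : star (ofPoly E x) = ofPoly E (star x) :=
  Completion.map_coe (star_isometry (E := E.PreAlg)).uniformContinuous x

theorem continuous_star' : Continuous (star : E.CStar → E.CStar) := Completion.continuous_map

instance : StarRing E.CStar where
  star_involutive x := by
    refine denseRange_ofPoly.induction_on x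
      (isClosed_eq (continuous_star'.comp continuous_star') continuous_id) fun a => ?_
    simp [star_ofPoly]
  star_mul x y := by
    refine denseRange_ofPoly.induction_on₂ (p := fun x y : E.CStar => star (x * y) = star y * star x)
      (isClosed_eq (continuous_star'.comp continuous_mul)
        ((continuous_star'.comp continuous_snd).mul (continuous_star'.comp continuous_fst)))
      (fun a b => ?_) x y
    rw [← map_mul, star_ofPoly, star_ofPoly, star_ofPoly, star_mul, map_mul]
  star_add x y := by
    refine denseRange_ofPoly.induction_on₂ (p := fun x y : E.CStar => star (x + y) = star x + star y)
      (isClosed_eq (continuous_star'.comp continuous_add)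
        ((continuous_star'.comp continuous_fst).add (continuous_star'.comp continuous_snd)))
      (fun a b => ?_) x y
    rw [← map_add, star_ofPoly, star_ofPoly, star_ofPoly, star_add, map_add]

instance : CStarAlgebra E.CStar where
  norm_mul_self_le x := by
    refine denseRange_ofPoly.induction_on x
      (isClosed_le (continuous_norm.mul continuous_norm)
        (continuous_norm.comp (continuous_star'.mul continuous_id))) fun a => ?_
    change ‖ofPoly E a‖ * ‖ofPoly E a‖ ≤ ‖star (ofPoly E a) * ofPoly E a‖
    rw [star_ofPoly, ← map_mul, norm_ofPoly, norm_ofPoly,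
      PreAlg.admissible_univNorm.star_mul_self]
  star_smul c x := by
    refine denseRange_ofPoly.induction_on x
      (isClosed_eq (continuous_star'.comp (continuous_const_smul c))
        (continuous_star'.const_smul (star c))) fun a => ?_
    rw [← map_smul, star_ofPoly, star_ofPoly, star_smul, map_smul]

/-- `ofPoly` as a `*`-homomorphism. -/
def ofPolyStar : E.PreAlg →⋆ₐ[ℂ] E.CStar where
  __ := ofPoly E
  map_star' x := (star_ofPoly x).symm

variable (E) in
/-- The vertex projection `P_v`. -/
def P (v : V) : E.CStar := ofPoly E (PreAlg.vert E v)

variable (E) in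
/-- The partial isometry `S_e`. -/
def S (e : Ed) : E.CStar := ofPoly E (PreAlg.edge E e)

variable (E) in
theorem isCKFamily : E.IsCKFamily (P E) (S E) :=
  PreAlg.admissible_univNorm.relations.map ofPolyStar fun x y h => by
    rw [← sub_eq_zero, ← map_sub, ← norm_eq_zero]
    exact (norm_ofPoly (x - y)).trans h

section Lift

variable {B : Type*} [CStarAlgebra B] {p : V → B} {q : Ed → B}

/-- Evaluation of `*`-polynomials at a Cuntz-Krieger family. -/
def evalPoly (p : V → B) (q : Ed → B) : E.PreAlg →⋆ₐ[ℂ] B := FreeStarAlg.eval (Sum.elim p q)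

set_option linter.unusedSectionVars false in
theorem evalPoly_vert (v : V) : evalPoly p q (PreAlg.vert E v) = p v :=
  FreeStarAlg.eval_gen (Sum.elim p q) (Sum.inl v)

set_option linter.unusedSectionVars false in
theorem evalPoly_edge (e : Ed) : evalPoly p q (PreAlg.edge E e) = q e :=
  FreeStarAlg.eval_gen (Sum.elim p q) (Sum.inr e)

theorem norm_evalPoly_le (h : E.IsCKFamily p q) (x : E.PreAlg) :
    ‖(evalPoly p q : E.PreAlg →⋆ₐ[ℂ] B) x‖ ≤ PreAlg.univNorm x := by
  refine PreAlg.le_univNorm (p := fun x => ‖(evalPoly p q : E.PreAlg →⋆ₐ[ℂ] B) x‖)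
    { add_le := fun x y => by rw [map_add]; exact norm_add_le _ _
      smul_eq := fun c x => by rw [map_smul, norm_smul]
      mul_le := fun x y => by rw [map_mul]; exact norm_mul_le _ _
      star_mul_self := fun x => by rw [map_mul, map_star, CStarRing.norm_star_mul_self]
      relations := ?_ } x
  have hφ : ∀ x y : E.PreAlg, (evalPoly p q : E.PreAlg →⋆ₐ[ℂ] B) x =
      (evalPoly p q : E.PreAlg →⋆ₐ[ℂ] B) y →
      ‖(evalPoly p q : E.PreAlg →⋆ₐ[ℂ] B) (x - y)‖ = 0 := fun x y h => by
    rw [map_sub, h, sub_self, norm_zero]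
  constructor
  · intro v
    exact hφ _ _ (by simpa [evalPoly_vert, map_star] using h.vertex_star v)
  · intro v
    exact hφ _ _ (by simpa [evalPoly_vert] using h.vertex_idem v)
  · intro v w hvw
    exact hφ _ _ (by simpa [evalPoly_vert] using h.vertex_orth v w hvw)
  · exact hφ _ _ (by simpa [evalPoly_vert] using h.vertex_sum)
  · intro e
    exact hφ _ _ (by simpa [evalPoly_vert, evalPoly_edge, map_star] using h.edge_initial e)
  · intro e f hef
    exact hφ _ _ (by simpa [evalPoly_edge, map_star] using h.edge_orth e f hef)
  · intro e
    exact hφ _ _ (by simpa [evalPoly_vert, evalPoly_edge, map_star] using h.edge_le e)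
  · intro v hv
    exact hφ _ _ (by simpa [evalPoly_vert, evalPoly_edge, map_star] using h.edge_sum v hv)

theorem continuous_evalPoly (h : E.IsCKFamily p q) :
    Continuous (evalPoly p q : E.PreAlg →⋆ₐ[ℂ] B) :=
  AddMonoidHomClass.continuous_of_bound (evalPoly p q : E.PreAlg →⋆ₐ[ℂ] B) 1 fun x => by
    rw [one_mul]; exact norm_evalPoly_le h x

/-- The homomorphism underlying `lift`. -/
def liftRingHom (h : E.IsCKFamily p q) : E.CStar →+* B :=
  Completion.extensionHom ((evalPoly p q : E.PreAlg →⋆ₐ[ℂ] B) : E.PreAlg →+* B)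
    (continuous_evalPoly h)

theorem liftRingHom_ofPoly (h : E.IsCKFamily p q) (x : E.PreAlg) :
    liftRingHom h (ofPoly E x) = evalPoly p q x :=
  Completion.extensionHom_coe _ (continuous_evalPoly h) x

theorem continuous_liftRingHom (h : E.IsCKFamily p q) : Continuous (liftRingHom h) :=
  Completion.continuous_extension

/-- The universal property of `C*(E)`: every Cuntz-Krieger `E`-family in a `C*`-algebra `B`
induces a `*`-homomorphism `C*(E) → B`. -/
def lift (h : E.IsCKFamily p q) : E.CStar →⋆ₐ[ℂ] B where
  __ := liftRingHom h
  commutes' c := by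
    change liftRingHom h (algebraMap ℂ E.CStar c) = _
    rw [← (ofPoly E).commutes, liftRingHom_ofPoly, AlgHomClass.commutes]
  map_star' x := by
    change liftRingHom h (star x) = star (liftRingHom h x)
    refine denseRange_ofPoly.induction_on x
      (isClosed_eq ((continuous_liftRingHom h).comp continuous_star')
        (continuous_star.comp (continuous_liftRingHom h))) fun a => ?_
    rw [star_ofPoly, liftRingHom_ofPoly, liftRingHom_ofPoly, map_star]

theorem lift_P (h : E.IsCKFamily p q) (v : V) : lift h (P E v) = p v :=
  (liftRingHom_ofPoly h _).trans (evalPoly_vert v)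

theorem lift_S (h : E.IsCKFamily p q) (e : Ed) : lift h (S E e) = q e :=
  (liftRingHom_ofPoly h _).trans (evalPoly_edge e)

/-- A `*`-homomorphism on `C*(E)` is determined by its values on the generators. -/
theorem hom_ext {φ ψ : E.CStar →⋆ₐ[ℂ] B} (hP : ∀ v, φ (P E v) = ψ (P E v))
    (hS : ∀ e, φ (S E e) = ψ (S E e)) : φ = ψ := by
  have h : φ.comp ofPolyStar = ψ.comp ofPolyStar := by
    refine FreeStarAlg.hom_ext (G := V ⊕ Ed) ?_
    rintro (v | e)
    · exact hP v
    · exact hS e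
  have hc : ∀ φ : E.CStar →⋆ₐ[ℂ] B, Continuous φ := fun φ =>
    AddMonoidHomClass.continuous_of_bound φ 1 fun x => by
      rw [one_mul]; exact NonUnitalStarAlgHom.norm_apply_le φ x
  refine StarAlgHom.ext fun x => ?_
  exact denseRange_ofPoly.induction_on x (isClosed_eq (hc φ) (hc ψ)) fun a => DFunLike.congr_fun h a

end Lift

end CStar

/-! ## Endomorphisms determined by unitaries -/

/-- For a path `μ = (μ_1, …, μ_n)` the element `S_μ = S_{μ_1} ⋯ S_{μ_n}` of `C*(E)`; for a path of
length `0`, that is a vertex `v`, it is `P_v`. (The factor `P_{s(μ)}` is absorbed if `n ≥ 1`.) -/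
def SPath {n : ℕ} (μ : E.Path n) : E.CStar :=
  CStar.P E μ.src * (μ.edges.map (CStar.S E)).prod

/-- `U_E`: the unitaries of `C*(E)` that commute with all vertex projections. -/
def UE : Set E.CStar := {u | u ∈ unitary E.CStar ∧ ∀ v, u * CStar.P E v = CStar.P E v * u}

/-- `P_E^k`: the unitaries of `C*(E)` that are finite sums of elements `S_α S_β^*` with `α`, `β`
paths of length `k`. -/
def PE (k : ℕ) : Set E.CStar :=
  {u | u ∈ unitary E.CStar ∧
    ∃ T : Finset (E.Path k × E.Path k), u = ∑ t ∈ T, E.SPath t.1 * star (E.SPath t.2)}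

variable {E}

theorem isCKFamily_of_mem_UE {u : E.CStar} (hu : u ∈ E.UE) :
    E.IsCKFamily (CStar.P E) (fun e => u * CStar.S E e) := by
  obtain ⟨hu, hc⟩ := hu
  have h := CStar.isCKFamily E
  have huu : star u * u = 1 := Unitary.star_mul_self_of_mem hu
  have huu' : u * star u = 1 := Unitary.mul_star_self_of_mem hu
  have hS : ∀ e f, star (u * CStar.S E e) * (u * CStar.S E f) =
      star (CStar.S E e) * CStar.S E f := fun e f => by
    rw [star_mul, mul_assoc, ← mul_assoc (star u), huu, one_mul]
  have hS' : ∀ e, u * CStar.S E e * star (u * CStar.S E e) =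
      u * (CStar.S E e * star (CStar.S E e)) * star u := fun e => by
    rw [star_mul]; simp only [mul_assoc]
  refine ⟨h.vertex_star, h.vertex_idem, h.vertex_orth, h.vertex_sum, fun e => ?_,
    fun e f hef => ?_, fun e => ?_, fun v hv => ?_⟩
  · rw [hS]; exact h.edge_initial e
  · rw [hS]; exact h.edge_orth e f hef
  · rw [hS', ← mul_assoc, ← mul_assoc, ← hc, mul_assoc u, h.edge_le e]
  · simp only [hS']
    rw [← Finset.sum_mul, ← Finset.mul_sum, ← h.edge_sum v hv, hc, mul_assoc, huu', mul_one]

/-- The endomorphism `λ_u` of `C*(E)` for `u ∈ U_E`, with `λ_u (S_e) = u S_e` and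
`λ_u (P_v) = P_v`. -/
def lam (u : E.CStar) (hu : u ∈ E.UE) : E.CStar →⋆ₐ[ℂ] E.CStar :=
  CStar.lift (isCKFamily_of_mem_UE hu)

theorem lam_S (u : E.CStar) (hu : u ∈ E.UE) (e : Ed) : lam u hu (CStar.S E e) = u * CStar.S E e :=
  CStar.lift_S _ e

theorem lam_P (u : E.CStar) (hu : u ∈ E.UE) (v : V) : lam u hu (CStar.P E v) = CStar.P E v :=
  CStar.lift_P _ v

end CStar

/-! ## The combinatorial conditions -/

section Combinatorics

/-- A permutation of `E^n` that preserves the source and the range of every path: the union of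
permutations of the sets of paths with given source and range. -/
structure PathPerm (n : ℕ) where
  toPerm : Equiv.Perm (E.Path n)
  src_eq : ∀ μ, (toPerm μ).src = μ.src
  rng_eq : ∀ μ, (toPerm μ).rng = μ.rng

variable {E} {n : ℕ}

/-- The permutation `σ` corresponds to `u`: one has `u = ∑_{α ∈ E^n} S_{σ(α)} S_α^*`. -/
def PathPerm.Represents [Fintype V] [Fintype Ed] (σ : E.PathPerm n) (u : E.CStar) : Prop :=
  u = ∑ α : E.Path n, E.SPath (σ.toPerm α) * star (E.SPath α)

namespace PathPerm

variable (σ : E.PathPerm (n + 1))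

/-- The map `f_e` from the paths of length `n` with source `r(e)` to the paths of length `n` with
source `s(e)`: `f_e(α) = β` if and only if `σ(e, α) = (β, g)` for some edge `g`. -/
def f (e : Ed) (α : {α : E.Path n // α.src = E.r e}) : {β : E.Path n // β.src = E.s e} :=
  ⟨(σ.toPerm (α.1.cons e α.2)).init, σ.src_eq (α.1.cons e α.2)⟩

/-- The pairs of paths of length `n` with a common source. -/
abbrev SrcPairs (E : DirGraph V Ed) (n : ℕ) : Type _ :=
  {p : E.Path n × E.Path n // p.1.src = p.2.src}

/-- The pair `(α, β)` for two paths with source `v`. -/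
def srcPair {v : V} (α β : {α : E.Path n // α.src = v}) : SrcPairs E n :=
  ⟨(α.1, β.1), α.2.trans β.2.symm⟩

/-- The first order condition. There is a partial order on the pairs of paths of length `n` with
a common source such that the minimal elements are exactly the diagonal elements and the pairs
whose common source is not the range of an edge, and such that
`(f_e(α), f_e(β)) < (α, β)` for all edges `e` and all distinct `α`, `β` with source `r(e)`. -/
def DiagonalOrderCondition : Prop :=
  ∃ _ : PartialOrder (SrcPairs E n),
    (∀ p : SrcPairs E n, IsMin p ↔ (∀ e, E.r e ≠ p.1.1.src) ∨ p.1.1 = p.1.2) ∧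
    ∀ (e : Ed) (α β : {α : E.Path n // α.src = E.r e}), α ≠ β →
      srcPair (σ.f e α) (σ.f e β) < srcPair α β

/-- `Ψ`: the pairs of distinct paths of length `n`. -/
abbrev Psi (E : DirGraph V Ed) (n : ℕ) : Type _ := {p : E.Path n × E.Path n // p.1 ≠ p.2}

/-- The partially defined map `f_{e,g}` on `Ψ`, given by its graph: `f_{e,g}(α, β)` is defined and
equal to `(γ, δ)` if and only if `α` has source `r(e)`, `β` has source `r(g)`, and there is an edge
`h` with `σ(e, α) = (γ, h)` and `σ(g, β) = (δ, h)`. -/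
def PairMap (e g : Ed) (p q : Psi E n) : Prop :=
  ∃ (hα : p.1.1.src = E.r e) (hβ : p.1.2.src = E.r g),
    (σ.toPerm (p.1.1.cons e hα)).init = q.1.1 ∧ (σ.toPerm (p.1.2.cons g hβ)).init = q.1.2 ∧
    (σ.toPerm (p.1.1.cons e hα)).last = (σ.toPerm (p.1.2.cons g hβ)).last

/-- `Δ`: the pairs that lie in the domain of at least one of the maps `f_{e,g}`. -/
def Delta : Set (Psi E n) := {p | ∃ e g q, σ.PairMap e g p q}

/-- The second order condition. There is a partial order on `Ψ` whose set of minimal elements is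
`Ψ \ Δ`, such that `f_{e,g}(α, β) < (α, β)` for all edges `e`, `g` and all `(α, β)` in the domain
of `f_{e,g}`. -/
def OffDiagonalOrderCondition : Prop :=
  ∃ _ : PartialOrder (Psi E n),
    {p : Psi E n | IsMin p} = {p : Psi E n | p ∉ σ.Delta} ∧
    ∀ (e g : Ed) (p q : Psi E n), σ.PairMap e g p q → q < p

/-- If `σ(e, α) = (γ, h)` and `σ(g, β) = (δ, h)` with `α ≠ β`, then `γ ≠ δ`. -/
theorem init_ne {e g : Ed} {α β : E.Path n} (h : α ≠ β) (hα : α.src = E.r e) (hβ : β.src = E.r g)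
    (hl : (σ.toPerm (α.cons e hα)).last = (σ.toPerm (β.cons g hβ)).last) :
    (σ.toPerm (α.cons e hα)).init ≠ (σ.toPerm (β.cons g hβ)).init := by
  intro hi
  have h1 := σ.toPerm.injective (Path.ext_init_last hi hl)
  have h2 : (α.cons e hα).edges = (β.cons g hβ).edges := by rw [h1]
  have h3 := List.cons.inj h2
  exact h (Path.ext (by rw [hα, hβ, h3.1]) h3.2)

end PathPerm

end Combinatorics

end DirGraph

end

noncomputable section

open scoped InnerProductSpace

/-! ## Operators on `ℓ²` induced by partial bijections -/

namespace PEquiv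

variable {Z : Type*}

open Classical in
theorem sum_elim_le (f : Z ≃. Z) (ξ : lp (fun _ : Z => ℂ) 2) (s : Finset Z) :
    ∑ z ∈ s, ‖((f.symm z).elim 0 ξ : ℂ)‖ ^ (2 : ENNReal).toReal ≤ ‖ξ‖ ^ (2 : ENNReal).toReal := by
  refine le_trans ?_ (lp.sum_rpow_le_norm_rpow (by norm_num) ξ (s.biUnion fun z => (f.symm z).toFinset))
  have h0 : ∀ z, ‖((f.symm z).elim 0 ξ : ℂ)‖ ^ (2 : ENNReal).toReal =
      ∑ y ∈ (f.symm z).toFinset, ‖ξ y‖ ^ (2 : ENNReal).toReal := fun z => by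
    cases h : f.symm z <;> simp
  rw [Finset.sum_biUnion]
  · exact (Finset.sum_congr rfl fun z _ => h0 z).le
  · intro a _ b _ hab
    refine Finset.disjoint_left.2 fun y hy hy' => hab ?_
    rw [Option.mem_toFinset, Option.mem_def, PEquiv.eq_some_iff] at hy hy'
    exact Option.some_injective _ (hy.symm.trans hy')

/-- The partial isometry of `ℓ²(Z)` induced by a partial bijection of `Z`. -/
def partialIsometry (f : Z ≃. Z) : lp (fun _ : Z => ℂ) 2 →L[ℂ] lp (fun _ : Z => ℂ) 2 :=
  LinearMap.mkContinuous
    { toFun := fun ξ => ⟨fun z => (f.symm z).elim 0 ξ, memℓp_gen' (f.sum_elim_le ξ)⟩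
      map_add' := fun ξ η => by
        ext z
        change (f.symm z).elim 0 (ξ + η : lp (fun _ : Z => ℂ) 2) = (f.symm z).elim 0 ξ + (f.symm z).elim 0 η
        cases f.symm z <;> simp only [Option.elim_none, Option.elim_some, add_zero, lp.coeFn_add, Pi.add_apply]
      map_smul' := fun c ξ => by
        ext z
        change (f.symm z).elim 0 (c • ξ : lp (fun _ : Z => ℂ) 2) = c * (f.symm z).elim 0 ξ
        cases f.symm z <;> simp } 1 fun ξ => by
    rw [one_mul]
    exact lp.norm_le_of_forall_sum_le (by norm_num) (norm_nonneg _) (f.sum_elim_le ξ)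

theorem partialIsometry_apply (f : Z ≃. Z) (ξ : lp (fun _ : Z => ℂ) 2) (z : Z) :
    f.partialIsometry ξ z = (f.symm z).elim 0 ξ := rfl

open Classical in
/-- The standard basis vectors of `ℓ²(Z)`. -/
def basisVec (z : Z) : lp (fun _ : Z => ℂ) 2 := lp.single 2 z 1

open Classical in
theorem basisVec_self (z : Z) : basisVec z z = 1 := lp.single_apply_self _ _ _

open Classical in
theorem basisVec_ne {y z : Z} (h : y ≠ z) : basisVec z y = 0 := lp.single_apply_ne _ _ _ h

open Classical in
theorem norm_basisVec (z : Z) : ‖basisVec z‖ = 1 := by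
  rw [basisVec, lp.norm_single (by norm_num), norm_one]

open Classical in
theorem inner_basisVec_left (z : Z) (ξ : lp (fun _ : Z => ℂ) 2) : ⟪basisVec z, ξ⟫_ℂ = ξ z := by
  rw [basisVec, lp.inner_single_left]; simp

theorem partialIsometry_basisVec (f : Z ≃. Z) (z : Z) :
    f.partialIsometry (basisVec z) = (f z).elim 0 basisVec := by
  ext y
  rw [partialIsometry_apply]
  have key : f.symm y = some z ↔ f z = some y := f.eq_some_iff
  by_cases h : f z = some y
  · rw [key.2 h, h]
    simp [basisVec_self]
  · have h1 : (f.symm y).elim (0 : ℂ) (basisVec z) = 0 := by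
      cases h' : f.symm y with
      | none => rfl
      | some w => exact basisVec_ne fun hw => h (key.1 (by rw [h', hw]))
    have h2 : ((f z).elim 0 basisVec : lp (fun _ : Z => ℂ) 2) y = 0 := by
      cases h' : f z with
      | none => rfl
      | some w => exact basisVec_ne fun hw => h (by rw [h', hw])
    rw [h1, h2]

theorem star_partialIsometry (f : Z ≃. Z) :
    star f.partialIsometry = f.symm.partialIsometry := by
  rw [ContinuousLinearMap.star_eq_adjoint]
  ext ξ z
  rw [← inner_basisVec_left, ContinuousLinearMap.adjoint_inner_right, partialIsometry_basisVec,
    partialIsometry_apply, PEquiv.symm_symm]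
  cases f z with
  | none => simp
  | some y => exact inner_basisVec_left y ξ

end PEquiv

namespace DirGraph

variable {V Ed : Type*} {E : DirGraph V Ed}

/-- A bijection compatible with the source map; it exists because every vertex emits an edge. -/
theorem NoSinks.exists_branching [Countable Ed] (h : E.NoSinks) :
    ∃ Φ : Ed × ℕ ≃ V × ℕ, ∀ p, (Φ p).1 = E.s p.1 := by
  have hv : ∀ v, Nonempty ({p : Ed × ℕ // E.s p.1 = v} ≃ ℕ) := fun v => by
    obtain ⟨e, he⟩ := h v
    have : Infinite {p : Ed × ℕ // E.s p.1 = v} :=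
      Infinite.of_injective (fun i : ℕ => ⟨(e, i), he⟩) fun i j hij => by simpa using hij
    exact nonempty_equiv_of_countable
  refine ⟨(Equiv.sigmaFiberEquiv fun p : Ed × ℕ => E.s p.1).symm.trans
    ((Equiv.sigmaCongrRight fun v => (hv v).some).trans (Equiv.sigmaEquivProd V ℕ)), fun p => rfl⟩

open Classical in
/-- The partial bijection of `V × ℕ × ℤ` by which an edge acts. -/
def edgeShift (Φ : Ed × ℕ ≃ V × ℕ) (e : Ed) : (V × ℕ) × ℤ ≃. (V × ℕ) × ℤ where
  toFun z := if z.1.1 = E.r e then some (Φ (e, z.1.2), z.2 + 1) else none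
  invFun z := if (Φ.symm z.1).1 = e then some ((E.r e, (Φ.symm z.1).2), z.2 - 1) else none
  inv := by
    rintro ⟨⟨v, i⟩, j⟩ ⟨⟨w, k⟩, l⟩
    constructor
    · intro h
      split_ifs at h with h1
      simp only [Option.some.injEq, Prod.mk.injEq] at h
      obtain ⟨⟨rfl, rfl⟩, rfl⟩ := h
      subst h1
      simp
    · intro h
      split_ifs at h with h1
      simp only [Option.some.injEq, Prod.mk.injEq] at h
      obtain ⟨h2, rfl⟩ := h
      rw [← h2]
      simp at h1
      simp [h1]

open Classical in
theorem edgeShift_apply (Φ : Ed × ℕ ≃ V × ℕ) (e : Ed) (z : (V × ℕ) × ℤ) :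
    edgeShift (E := E) Φ e z = if z.1.1 = E.r e then some (Φ (e, z.1.2), z.2 + 1) else none := rfl

open Classical in
/-- The partial identity by which a vertex acts. -/
def vertexId (v : V) : (V × ℕ) × ℤ ≃. (V × ℕ) × ℤ := PEquiv.ofSet {z | z.1.1 = v}

section

variable [Fintype V] [Fintype Ed]

theorem isCKFamily_partialIsometry {Φ : Ed × ℕ ≃ V × ℕ} (hΦ : ∀ p, (Φ p).1 = E.s p.1) :
    E.IsCKFamily (fun v => (vertexId v).partialIsometry)
      (fun e => (edgeShift (E := E) Φ e).partialIsometry) := by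
  classical
  have hPv : ∀ (v : V) ξ z, (vertexId v).partialIsometry ξ z = if z.1.1 = v then ξ z else 0 := by
    intro v ξ z
    rw [PEquiv.partialIsometry_apply]
    simp only [vertexId, PEquiv.ofSet_symm]
    by_cases h : z.1.1 = v <;> simp [PEquiv.ofSet, h]
  have hS : ∀ e ξ z, (edgeShift (E := E) Φ e).partialIsometry ξ z =
      if (Φ.symm z.1).1 = e then ξ ((E.r e, (Φ.symm z.1).2), z.2 - 1) else 0 := by
    intro e ξ z
    rw [PEquiv.partialIsometry_apply]
    change Option.elim (if _ then _ else _) _ _ = _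
    split_ifs <;> rfl
  have hS' : ∀ e ξ z, star (edgeShift (E := E) Φ e).partialIsometry ξ z =
      if z.1.1 = E.r e then ξ (Φ (e, z.1.2), z.2 + 1) else 0 := by
    intro e ξ z
    rw [PEquiv.star_partialIsometry, PEquiv.partialIsometry_apply, PEquiv.symm_symm]
    change Option.elim (if _ then _ else _) _ _ = _
    split_ifs <;> rfl
  have hsrc : ∀ z : V × ℕ, E.s (Φ.symm z).1 = z.1 := fun z => by rw [← hΦ]; simp
  have hSS : ∀ e ξ z, ((edgeShift (E := E) Φ e).partialIsometry *
      star (edgeShift (E := E) Φ e).partialIsometry) ξ z =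
      if (Φ.symm z.1).1 = e then ξ z else 0 := by
    intro e ξ z
    rw [mul_apply_eq_comp, hS]
    split_ifs with h
    · rw [hS', if_pos rfl]
      subst h
      simp
    · rfl
  constructor
  · intro v
    rw [PEquiv.star_partialIsometry]
    simp [vertexId]
  · intro v
    ext ξ z
    rw [mul_apply_eq_comp, hPv, hPv]
    split_ifs <;> rfl
  · intro v w h
    ext ξ z
    rw [mul_apply_eq_comp, hPv, hPv]
    split_ifs with h1 h2
    · exact absurd (h1.symm.trans h2) h
    · rfl
    · rfl
  · ext ξ z
    simp only [sum_apply, one_apply_eq_self]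
    rw [lp.coeFn_sum, Finset.sum_apply]
    simp [hPv]
  · intro e
    ext ξ z
    rw [mul_apply_eq_comp, hS', hPv]
    split_ifs with h
    · rw [hS, Equiv.symm_apply_apply, if_pos rfl]
      dsimp only
      rw [← h]
      simp
    · rfl
  · intro e f h
    ext ξ z
    rw [mul_apply_eq_comp, hS']
    split_ifs with h'
    · rw [hS, Equiv.symm_apply_apply, if_neg h]; rfl
    · rfl
  · intro e
    ext ξ z
    rw [mul_apply_eq_comp, hPv, hSS]
    split_ifs with h1 h2 h2
    · rfl
    · rfl
    · exact absurd (by rw [← h2, hsrc]) h1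
    · rfl
  · intro v _
    ext ξ z
    rw [hPv]
    simp only [sum_apply]
    rw [lp.coeFn_sum, Finset.sum_apply]
    simp only [hSS]
    rw [Finset.sum_ite_eq]
    simp [hsrc]

/-- For every vertex there is a bounded functional on `C*(E)` that has the value `1` at the vertex
projection and vanishes on all products of edges. -/
theorem CStar.exists_functional (h : E.NoSinks) (v : V) : ∃ ω : E.CStar →L[ℂ] ℂ,
    (∀ a, ‖ω a‖ ≤ ‖a‖) ∧ (∀ a, ω (star a) = star (ω a)) ∧ ω (CStar.P E v) = 1 ∧
    ∀ l : List Ed, l ≠ [] → ω (l.map (CStar.S E)).prod = 0 := by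
  classical
  obtain ⟨Φ, hΦ⟩ := h.exists_branching
  obtain ⟨π, hP, hS⟩ : ∃ π : E.CStar →⋆ₐ[ℂ] (lp (fun _ : (V × ℕ) × ℤ => ℂ) 2 →L[ℂ]
      lp (fun _ : (V × ℕ) × ℤ => ℂ) 2), (∀ v, π (CStar.P E v) = (vertexId v).partialIsometry) ∧
      ∀ e, π (CStar.S E e) = (edgeShift (E := E) Φ e).partialIsometry :=
    ⟨CStar.lift (isCKFamily_partialIsometry hΦ), CStar.lift_P _, CStar.lift_S _⟩
  have hw : ∀ (l : List Ed) z, π (l.map (CStar.S E)).prod (PEquiv.basisVec z) = 0 ∨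
      ∃ y : (V × ℕ) × ℤ, y.2 = z.2 + l.length ∧
        π (l.map (CStar.S E)).prod (PEquiv.basisVec z) = PEquiv.basisVec y := by
    intro l z
    induction l with
    | nil => exact .inr ⟨z, by simp, by simp⟩
    | cons e l ih =>
      rw [List.map_cons, List.prod_cons, map_mul, mul_apply_eq_comp]
      rcases ih with ih | ⟨y, hy, ih⟩
      · exact .inl (by rw [ih, map_zero])
      · rw [ih, hS, PEquiv.partialIsometry_basisVec]
        rw [edgeShift_apply]
        split_ifs
        · exact .inr ⟨_, by simp only [hy, List.length_cons]; push_cast; ring, rfl⟩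
        · exact .inl rfl
  set δ : lp (fun _ : (V × ℕ) × ℤ => ℂ) 2 := PEquiv.basisVec ((v, 0), 0) with hδ
  have hδ1 : ‖δ‖ = 1 := PEquiv.norm_basisVec _
  have hb : ∀ a, ‖⟪δ, π a δ⟫_ℂ‖ ≤ ‖a‖ := fun a => by
    refine (norm_inner_le_norm _ _).trans ?_
    rw [hδ1, one_mul]
    refine ((π a).le_opNorm δ).trans ?_
    rw [hδ1, mul_one]
    exact NonUnitalStarAlgHom.norm_apply_le π a
  refine ⟨LinearMap.mkContinuous
    { toFun := fun a => ⟪δ, π a δ⟫_ℂ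
      map_add' := fun a b => by rw [map_add, add_apply, inner_add_right]
      map_smul' := fun c a => by
        rw [map_smul, smul_apply, inner_smul_right]; rfl } 1
    fun a => by rw [one_mul]; exact hb a, hb, fun a => ?_, ?_, fun l hl => ?_⟩
  · change ⟪δ, π (star a) δ⟫_ℂ = star ⟪δ, π a δ⟫_ℂ
    rw [map_star, ContinuousLinearMap.star_eq_adjoint, ContinuousLinearMap.adjoint_inner_right]
    exact (inner_conj_symm _ _).symm
  · change ⟪δ, π (CStar.P E v) δ⟫_ℂ = 1
    rw [hP, hδ, PEquiv.partialIsometry_basisVec]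
    have : vertexId v ((v, 0), (0 : ℤ)) = some ((v, 0), 0) := by simp [vertexId, PEquiv.ofSet]
    rw [this, Option.elim_some, ← hδ, inner_self_eq_norm_sq_to_K, hδ1]
    simp
  · change ⟪δ, π (l.map (CStar.S E)).prod δ⟫_ℂ = 0
    rcases hw l ((v, 0), 0) with h0 | ⟨y, hy, h0⟩
    · exact (congrArg (fun ξ => ⟪δ, ξ⟫_ℂ) h0).trans (inner_zero_right δ)
    · refine (congrArg (fun ξ => ⟪δ, ξ⟫_ℂ) h0).trans
        ((PEquiv.inner_basisVec_left _ _).trans (PEquiv.basisVec_ne ?_))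
      intro h1
      rw [← h1, zero_add, eq_comm, Int.natCast_eq_zero] at hy
      exact hl (List.length_eq_zero_iff.1 hy)

end

end DirGraph

end

noncomputable section

namespace DirGraph

variable {V Ed : Type*} {E : DirGraph V Ed}

/-! ## Paths -/

namespace Path

variable {n : ℕ}

theorem rng_cons (e : Ed) (α : E.Path n) (h : α.src = E.r e) : (α.cons e h).rng = α.rng := by
  change E.endpoint (E.r e) α.edges = E.endpoint α.src α.edges
  rw [h]

theorem exists_cons (μ : E.Path (n + 1)) :
    ∃ (e : Ed) (α : E.Path n) (h : α.src = E.r e), μ = α.cons e h := by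
  obtain ⟨v, l, hl, hw⟩ := μ
  cases l with
  | nil => simp at hl
  | cons e l =>
    obtain ⟨rfl, hw⟩ := hw
    exact ⟨e, ⟨E.r e, l, by simpa using hl, hw⟩, rfl, rfl⟩

theorem cons_inj {e g : Ed} {α β : E.Path n} {hα : α.src = E.r e} {hβ : β.src = E.r g}
    (h : α.cons e hα = β.cons g hβ) : e = g ∧ α = β := by
  have h2 : e :: α.edges = g :: β.edges := congrArg Path.edges h
  obtain ⟨rfl, h3⟩ := List.cons.inj h2
  exact ⟨rfl, Path.ext (by rw [hα, hβ]) h3⟩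

end Path

theorem endpoint_append (v : V) (l l' : List Ed) :
    E.endpoint v (l ++ l') = E.endpoint (E.endpoint v l) l' := by
  induction l generalizing v with
  | nil => rfl
  | cons e l ih => exact ih _

theorem isWalk_append {v : V} {l l' : List Ed} :
    E.IsWalk v (l ++ l') ↔ E.IsWalk v l ∧ E.IsWalk (E.endpoint v l) l' := by
  induction l generalizing v with
  | nil => simp [IsWalk, endpoint]
  | cons e l ih => simp [IsWalk, endpoint, ih, and_assoc]

namespace Path

variable {n : ℕ}

theorem edges_eq (μ : E.Path (n + 1)) : μ.edges = μ.init.edges ++ [μ.last] :=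
  (List.dropLast_append_getLast μ.edges_ne_nil).symm

theorem s_last (μ : E.Path (n + 1)) : E.s μ.last = μ.init.rng := by
  have h := μ.walk
  rw [edges_eq, isWalk_append] at h
  exact h.2.1

theorem rng_eq_last (μ : E.Path (n + 1)) : μ.rng = E.r μ.last := by
  unfold rng
  rw [edges_eq, endpoint_append]
  rfl

/-- Extension of a path by an edge at its range. -/
theorem exists_snoc (γ : E.Path n) (h : Ed) (hs : E.s h = γ.rng) :
    ∃ μ : E.Path (n + 1), μ.init = γ ∧ μ.last = h := by
  refine ⟨⟨γ.src, γ.edges ++ [h], by simp [γ.length_eq], isWalk_append.2 ⟨γ.walk, hs, trivial⟩⟩,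
    Path.ext rfl ?_, ?_⟩
  · simp [init]
  · simp [last]

end Path

theorem PathPerm.ext_toPerm {n : ℕ} {σ τ : E.PathPerm n} (h : ∀ μ, σ.toPerm μ = τ.toPerm μ) :
    σ = τ := by
  obtain ⟨σ, _, _⟩ := σ
  obtain ⟨τ, _, _⟩ := τ
  obtain rfl : σ = τ := Equiv.ext h
  rfl

/-! ## Computations in the graph algebra -/

variable [Fintype V] [Fintype Ed]

theorem CStar.ext_range {x y : E.CStar} (h : star (x - y) * (x - y) = 0) : x = y :=
  sub_eq_zero.1 ((CStarRing.star_mul_self_eq_zero_iff _).1 h)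

open CStar

theorem star_P (v : V) : star (P E v) = P E v := (isCKFamily E).vertex_star v

theorem P_mul_self (v : V) : P E v * P E v = P E v := (isCKFamily E).vertex_idem v

theorem P_mul_ne {v w : V} (h : v ≠ w) : P E v * P E w = 0 := (isCKFamily E).vertex_orth v w h

theorem sum_P : ∑ v, P E v = 1 := (isCKFamily E).vertex_sum

theorem star_S_mul_self (e : Ed) : star (S E e) * S E e = P E (E.r e) :=
  (isCKFamily E).edge_initial e

theorem star_S_mul_ne {e f : Ed} (h : e ≠ f) : star (S E e) * S E f = 0 :=
  (isCKFamily E).edge_orth e f h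

theorem S_mul_P (e : Ed) : S E e * P E (E.r e) = S E e := by
  apply CStar.ext_range
  have h := star_S_mul_self (E := E) e
  simp only [star_sub, star_mul, star_P, sub_mul, mul_sub]
  simp only [mul_assoc, h]
  simp only [← mul_assoc, h]
  simp [P_mul_self]

theorem S_mul_P_ne {e : Ed} {v : V} (h : v ≠ E.r e) : S E e * P E v = 0 := by
  rw [← S_mul_P, mul_assoc, P_mul_ne h.symm, mul_zero]

theorem P_mul_S (e : Ed) : P E (E.s e) * S E e = S E e := by
  have h := congrArg (· * S E e) ((isCKFamily E).edge_le e)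
  simpa only [mul_assoc, star_S_mul_self, S_mul_P] using h

theorem P_mul_S_ne {e : Ed} {v : V} (h : v ≠ E.s e) : P E v * S E e = 0 := by
  rw [← P_mul_S, ← mul_assoc, P_mul_ne h, zero_mul]

theorem NoSinks.sum_S (h : E.NoSinks) : ∑ e, S E e * star (S E e) = 1 := by
  classical
  rw [← sum_P]
  simp only [fun v => (isCKFamily E).edge_sum v (h v)]
  rw [← Finset.sum_fiberwise (s := Finset.univ) (g := E.s)]

variable (E) in
/-- The product of the elements `S_e` along a list of edges. -/
def word (l : List Ed) : E.CStar := (l.map (S E)).prod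

theorem word_nil : E.word [] = 1 := rfl

theorem word_cons (e : Ed) (l : List Ed) : E.word (e :: l) = S E e * E.word l := by
  simp [word]

theorem word_append (l l' : List Ed) : E.word (l ++ l') = E.word l * E.word l' := by
  simp [word]

theorem SPath_eq {n : ℕ} (μ : E.Path n) : E.SPath μ = P E μ.src * E.word μ.edges := rfl

theorem P_mul_SPath {n : ℕ} (μ : E.Path n) : P E μ.src * E.SPath μ = E.SPath μ := by
  rw [SPath_eq, ← mul_assoc, P_mul_self]

theorem P_mul_SPath_ne {n : ℕ} {μ : E.Path n} {v : V} (h : v ≠ μ.src) :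
    P E v * E.SPath μ = 0 := by
  rw [SPath_eq, ← mul_assoc, P_mul_ne h, zero_mul]

theorem SPath_cons {n : ℕ} (e : Ed) (α : E.Path n) (h : α.src = E.r e) :
    E.SPath (α.cons e h) = S E e * E.SPath α := by
  change P E (E.s e) * E.word (e :: α.edges) = _
  rw [word_cons, ← mul_assoc, P_mul_S, SPath_eq, h, ← mul_assoc, S_mul_P]

theorem S_mul_SPath_ne {n : ℕ} {e : Ed} {α : E.Path n} (h : α.src ≠ E.r e) :
    S E e * E.SPath α = 0 := by
  rw [SPath_eq, ← mul_assoc, S_mul_P_ne h, zero_mul]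

theorem SPath_eq_init_last {n : ℕ} (μ : E.Path (n + 1)) :
    E.SPath μ = E.SPath μ.init * S E μ.last := by
  rw [SPath_eq, SPath_eq, μ.edges_eq, word_append, ← mul_assoc]
  simp [word, Path.init]

theorem SPath_mul_P {n : ℕ} (μ : E.Path n) : E.SPath μ * P E μ.rng = E.SPath μ := by
  cases n with
  | zero =>
    obtain ⟨v, l, hl, hw⟩ := μ
    obtain rfl := List.length_eq_zero_iff.1 hl
    rw [SPath_eq]
    change P E v * 1 * P E v = P E v * 1
    rw [mul_one, P_mul_self]
  | succ n => rw [SPath_eq_init_last, μ.rng_eq_last, mul_assoc, S_mul_P]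

theorem SPath_mul_P_ne {n : ℕ} {μ : E.Path n} {v : V} (h : μ.rng ≠ v) :
    E.SPath μ * P E v = 0 := by
  rw [← SPath_mul_P, mul_assoc, P_mul_ne h, mul_zero]

theorem SPath_mul_S_ne {n : ℕ} {μ : E.Path n} {e : Ed} (h : μ.rng ≠ E.s e) :
    E.SPath μ * S E e = 0 := by
  rw [← SPath_mul_P, mul_assoc, P_mul_S_ne h, mul_zero]

theorem star_SPath_mul_self {n : ℕ} (μ : E.Path n) :
    star (E.SPath μ) * E.SPath μ = P E μ.rng := by
  induction n with
  | zero =>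
    obtain ⟨v, l, hl, hw⟩ := μ
    obtain rfl := List.length_eq_zero_iff.1 hl
    rw [SPath_eq]
    change star (P E v * 1) * (P E v * 1) = P E v
    rw [mul_one, star_P, P_mul_self]
  | succ n ih =>
    obtain ⟨e, α, h, rfl⟩ := μ.exists_cons
    rw [SPath_cons, star_mul, mul_assoc, ← mul_assoc (star (S E e)), star_S_mul_self, ← h,
      P_mul_SPath, ih, Path.rng_cons]

theorem star_SPath_mul_ne {n : ℕ} {μ ν : E.Path n} (h : μ ≠ ν) :
    star (E.SPath μ) * E.SPath ν = 0 := by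
  induction n with
  | zero =>
    obtain ⟨v, l, hl, hw⟩ := μ
    obtain rfl := List.length_eq_zero_iff.1 hl
    obtain ⟨w, l, hl, hw⟩ := ν
    obtain rfl := List.length_eq_zero_iff.1 hl
    rw [SPath_eq, SPath_eq]
    change star (P E v * 1) * (P E w * 1) = 0
    rw [mul_one, mul_one, star_P, P_mul_ne]
    rintro rfl
    exact h rfl
  | succ n ih =>
    obtain ⟨e, α, hα, rfl⟩ := μ.exists_cons
    obtain ⟨g, β, hβ, rfl⟩ := ν.exists_cons
    rw [SPath_cons, SPath_cons, star_mul, mul_assoc, ← mul_assoc (star (S E e))]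
    by_cases heg : e = g
    · subst heg
      rw [star_S_mul_self, ← hβ, P_mul_SPath]
      exact ih fun h' => h (by subst h'; rfl)
    · rw [star_S_mul_ne heg, zero_mul, mul_zero]

theorem sum_path_succ {n : ℕ} {M : Type*} [AddCommMonoid M] (F : E.Path (n + 1) → M)
    (G : Ed → E.Path n → M) (hG : ∀ e α (h : α.src = E.r e), G e α = F (α.cons e h))
    (hG' : ∀ e α, α.src ≠ E.r e → G e α = 0) : ∑ μ, F μ = ∑ e, ∑ α, G e α := by
  classical
  rw [← Finset.sum_product']
  have h : ∀ p : Ed × E.Path n, G p.1 p.2 ≠ 0 → p.2.src = E.r p.1 := fun p hp => by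
    by_contra h'
    exact hp (hG' _ _ h')
  symm
  refine Finset.sum_bij_ne_zero (fun p _ hp => p.2.cons p.1 (h p hp)) (fun _ _ _ => Finset.mem_univ _)
    ?_ ?_ ?_
  · intro p _ hp q _ hq hpq
    obtain ⟨h1, h2⟩ := Path.cons_inj hpq
    exact Prod.ext h1 h2
  · intro μ _ hμ
    obtain ⟨e, α, h', rfl⟩ := μ.exists_cons
    exact ⟨(e, α), Finset.mem_univ _, by rwa [hG e α h'], rfl⟩
  · intro p _ hp
    exact hG _ _ _

theorem NoSinks.sum_SPath (h : E.NoSinks) (n : ℕ) :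
    ∑ μ : E.Path n, E.SPath μ * star (E.SPath μ) = 1 := by
  induction n with
  | zero =>
    rw [← sum_P]
    refine Fintype.sum_bijective (fun μ : E.Path 0 => μ.src) ⟨?_, ?_⟩ _ _ ?_
    · rintro ⟨v, l, hl, hw⟩ ⟨w, l', hl', hw'⟩ hvw
      refine Path.ext hvw ?_
      exact (List.length_eq_zero_iff.1 hl).trans (List.length_eq_zero_iff.1 hl').symm
    · intro v
      exact ⟨⟨v, [], rfl, trivial⟩, rfl⟩
    · rintro ⟨v, l, hl, hw⟩
      obtain rfl := List.length_eq_zero_iff.1 hl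
      change (P E v * 1) * star (P E v * 1) = P E v
      rw [mul_one, star_P, P_mul_self]
  | succ n ih =>
    rw [sum_path_succ _ (fun e α => S E e * (E.SPath α * star (E.SPath α)) * star (S E e)),
      ← h.sum_S]
    · simp only [← Finset.sum_mul, ← Finset.mul_sum, ih, mul_one]
    · intro e α h
      rw [SPath_cons, star_mul]
      simp only [mul_assoc]
    · intro e α h
      rw [← mul_assoc, S_mul_SPath_ne h, zero_mul, zero_mul]

theorem NoSinks.P_ne_zero (h : E.NoSinks) (v : V) : P E v ≠ 0 := by
  obtain ⟨ω, -, -, h1, -⟩ := CStar.exists_functional h v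
  intro h0
  rw [h0, map_zero] at h1
  exact zero_ne_one h1

theorem NoSinks.SPath_injective (h : E.NoSinks) (n : ℕ) :
    Function.Injective (E.SPath (n := n)) := by
  intro μ ν hμν
  by_contra hne
  have h1 := star_SPath_mul_ne hne
  rw [← hμν, star_SPath_mul_self] at h1
  exact h.P_ne_zero _ h1

/-! ## Permutations of paths -/

theorem PathPerm.Represents.mul_SPath {n : ℕ} {σ : E.PathPerm n} {u : E.CStar}
    (h : σ.Represents u) (μ : E.Path n) : u * E.SPath μ = E.SPath (σ.toPerm μ) := by
  rw [h, Finset.sum_mul, Finset.sum_eq_single μ]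
  · rw [mul_assoc, star_SPath_mul_self, ← σ.rng_eq, SPath_mul_P]
  · intro ν _ hν
    rw [mul_assoc, star_SPath_mul_ne hν, mul_zero]
  · simp

theorem existsUnique_represents (h : E.NoSinks) {n : ℕ} {u : E.CStar} (hP : u ∈ E.PE n)
    (hU : u ∈ E.UE) : ∃! σ : E.PathPerm n, σ.Represents u := by
  classical
  obtain ⟨huu, T, hT⟩ := hP
  have huu : star u * u = 1 := Unitary.star_mul_self_of_mem huu
  have hu : ∀ β, u * E.SPath β =
      ∑ α with (α, β) ∈ T ∧ α.rng = β.rng, E.SPath α := by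
    intro β
    have h1 : u * E.SPath β =
        ∑ t ∈ T, if t.2 = β ∧ t.1.rng = β.rng then E.SPath t.1 else 0 := by
      rw [hT, Finset.sum_mul]
      refine Finset.sum_congr rfl fun t _ => ?_
      by_cases h1 : t.2 = β
      · rw [← h1, mul_assoc, star_SPath_mul_self]
        by_cases h2 : t.1.rng = t.2.rng
        · rw [if_pos ⟨rfl, h2⟩, ← h2, SPath_mul_P]
        · rw [if_neg (by tauto), SPath_mul_P_ne h2]
      · rw [mul_assoc, star_SPath_mul_ne h1, mul_zero, if_neg (by tauto)]
    rw [h1, ← Finset.sum_filter]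
    refine Finset.sum_bij (fun t _ => t.1) ?_ ?_ ?_ ?_
    · rintro ⟨a, b⟩ ht
      simp only [Finset.mem_filter, Finset.mem_univ, true_and] at ht ⊢
      obtain ⟨hmem, rfl, hr⟩ := ht
      exact ⟨hmem, hr⟩
    · rintro ⟨a, b⟩ ht ⟨a', b'⟩ ht' hab
      simp only [Finset.mem_filter] at ht ht' hab
      obtain ⟨-, rfl, -⟩ := ht
      obtain ⟨-, rfl, -⟩ := ht'
      rw [hab]
    · intro a ha
      simp only [Finset.mem_filter, Finset.mem_univ, true_and] at ha
      exact ⟨(a, β), by simp [ha], rfl⟩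
    · intro _ _; rfl
  have hcard : ∀ β : E.Path n,
      (Finset.univ.filter fun α : E.Path n => (α, β) ∈ T ∧ α.rng = β.rng).card = 1 := by
    intro β
    have h1 : star (u * E.SPath β) * (u * E.SPath β) = P E β.rng := by
      rw [star_mul, mul_assoc, ← mul_assoc (star u), huu, one_mul, star_SPath_mul_self]
    have h2 : star (u * E.SPath β) * (u * E.SPath β) =
        ((Finset.univ.filter fun α : E.Path n => (α, β) ∈ T ∧ α.rng = β.rng).card : ℂ) •
          P E β.rng := by
      rw [hu, star_sum, Finset.sum_mul]
      have h3 : ∀ α ∈ Finset.univ.filter (fun α : E.Path n => (α, β) ∈ T ∧ α.rng = β.rng),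
          star (E.SPath α) * ∑ α with (α, β) ∈ T ∧ α.rng = β.rng, E.SPath α = P E β.rng := by
        intro α hα
        rw [Finset.mul_sum, Finset.sum_eq_single α]
        · rw [star_SPath_mul_self, (Finset.mem_filter.1 hα).2.2]
        · intro b _ hb
          exact star_SPath_mul_ne hb.symm
        · exact fun h => absurd hα h
      rw [Finset.sum_congr rfl h3, Finset.sum_const, Nat.cast_smul_eq_nsmul]
    rw [h1] at h2
    have h3 : (1 - ((Finset.univ.filter
        fun α : E.Path n => (α, β) ∈ T ∧ α.rng = β.rng).card : ℂ)) • P E β.rng = 0 := by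
      rw [sub_smul, one_smul, ← h2, sub_self]
    rcases smul_eq_zero.1 h3 with h4 | h4
    · exact_mod_cast (sub_eq_zero.1 h4).symm
    · exact absurd h4 (h.P_ne_zero _)
  have hτ : ∀ β : E.Path n, ∃ α : E.Path n, α.rng = β.rng ∧ u * E.SPath β = E.SPath α := by
    intro β
    obtain ⟨α, hα⟩ := Finset.card_eq_one.1 (hcard β)
    refine ⟨α, ?_, by rw [hu, hα, Finset.sum_singleton]⟩
    have : α ∈ ({α} : Finset (E.Path n)) := Finset.mem_singleton_self α
    rw [← hα] at this
    exact (Finset.mem_filter.1 this).2.2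
  choose τ hτr hτ using hτ
  have hinj : Function.Injective τ := by
    intro β β' hb
    refine h.SPath_injective n ?_
    have h1 : u * E.SPath β = u * E.SPath β' := by rw [hτ, hτ, hb]
    have h2 := congrArg (star u * ·) h1
    simpa only [← mul_assoc, huu, one_mul] using h2
  have hsrc : ∀ β, (τ β).src = β.src := by
    intro β
    by_contra hne
    have h1 : P E β.src * E.SPath (τ β) = E.SPath (τ β) := by
      rw [← hτ, ← mul_assoc, ← hU.2, mul_assoc, P_mul_SPath]
    rw [P_mul_SPath_ne (Ne.symm hne)] at h1
    have h2 := star_SPath_mul_self (E := E) (τ β)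
    rw [← h1, mul_zero] at h2
    exact h.P_ne_zero _ h2.symm
  refine ⟨⟨Equiv.ofBijective τ (Finite.injective_iff_bijective.1 hinj), hsrc, hτr⟩, ?_, ?_⟩
  · change u = ∑ α, E.SPath (τ α) * star (E.SPath α)
    rw [← mul_one u, ← h.sum_SPath n, Finset.mul_sum]
    exact Finset.sum_congr rfl fun α _ => by rw [← mul_assoc, hτ]
  · intro σ hσ
    refine PathPerm.ext_toPerm fun μ => h.SPath_injective n ?_
    rw [← hσ.mul_SPath]
    exact hτ μ

theorem PathPerm.Represents.lam_S_mul_SPath {n : ℕ} {σ : E.PathPerm (n + 1)} {u : E.CStar}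
    (h : σ.Represents u) (hU : u ∈ E.UE) (e : Ed) (α : E.Path n) (hα : α.src = E.r e) :
    lam u hU (S E e) * E.SPath α = E.SPath (σ.toPerm (α.cons e hα)) := by
  rw [lam_S, mul_assoc, ← SPath_cons e α hα, h.mul_SPath]

theorem lam_S_mul_SPath_ne {n : ℕ} {u : E.CStar} (hU : u ∈ E.UE) {e : Ed} {α : E.Path n}
    (hα : α.src ≠ E.r e) : lam u hU (S E e) * E.SPath α = 0 := by
  rw [lam_S, mul_assoc, S_mul_SPath_ne hα, mul_zero]

end DirGraph

end

noncomputable section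

/-- An acyclic relation, read as "is greater than", extends to a partial order in which the minimal
elements are those without successors. -/
theorem exists_partialOrder_of_acyclic {ι : Type*} (R : ι → ι → Prop)
    (h : ∀ a, ¬ Relation.TransGen R a a) : ∃ _ : PartialOrder ι,
      (∀ p : ι, IsMin p ↔ ∀ q, ¬ R p q) ∧ ∀ p q : ι, R p q → q < p := by
  let o : PartialOrder ι :=
    { le := fun a b => Relation.ReflTransGen R b a
      le_refl := fun _ => .refl
      le_trans := fun _ _ _ hab hbc => hbc.trans hab
      le_antisymm := fun a b hab hba => by
        rcases Relation.reflTransGen_iff_eq_or_transGen.1 hab with h1 | h1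
        · exact h1
        · exact absurd (h1.trans_left hba) (h b) }
  have hlt : ∀ p q : ι, R p q → q < p := fun p q hpq =>
    lt_of_le_not_ge (Relation.ReflTransGen.single hpq)
      fun hqp => h p (Relation.TransGen.head' hpq hqp)
  refine ⟨o, fun p => ⟨fun hp q hpq => (hlt p q hpq).not_ge (hp (hlt p q hpq).le), ?_⟩, hlt⟩
  intro hp q hqp
  rcases Relation.reflTransGen_iff_eq_or_transGen.1 (show Relation.ReflTransGen R p q from hqp) with
    h1 | h1
  · exact h1 ▸ le_refl q
  · obtain ⟨t, ht, -⟩ := Relation.TransGen.head'_iff.1 h1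
    exact absurd ht (hp t)

namespace DirGraph

variable {V Ed : Type*} {E : DirGraph V Ed} [Fintype V] [Fintype Ed]

open CStar

/-! ## A dense set of monomials and compressions by long words -/

variable (E) in
/-- The linear span of the elements `S_l P_v S_{l'}^*`, with `l` and `l'` lists of edges. -/
def wordSpan : Submodule ℂ E.CStar :=
  Submodule.span ℂ (Set.range fun t : List Ed × V × List Ed =>
    E.word t.1 * P E t.2.1 * star (E.word t.2.2))

theorem word_mem_wordSpan (l : List Ed) (v : V) (l' : List Ed) :
    E.word l * P E v * star (E.word l') ∈ E.wordSpan :=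
  Submodule.subset_span ⟨(l, v, l'), rfl⟩

theorem mul_mem_wordSpan_of {a x : E.CStar}
    (h : ∀ l v l', a * (E.word l * P E v * star (E.word l')) ∈ E.wordSpan) (hx : x ∈ E.wordSpan) :
    a * x ∈ E.wordSpan := by
  induction hx using Submodule.span_induction with
  | mem x hx => obtain ⟨⟨l, v, l'⟩, rfl⟩ := hx; exact h l v l'
  | zero => rw [mul_zero]; exact zero_mem _
  | add x y _ _ hx hy => rw [mul_add]; exact add_mem hx hy
  | smul c x _ hx => rw [mul_smul_comm]; exact Submodule.smul_mem _ _ hx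

theorem P_mul_mem_wordSpan (w : V) {x : E.CStar} (hx : x ∈ E.wordSpan) :
    P E w * x ∈ E.wordSpan := by
  refine mul_mem_wordSpan_of (fun l v l' => ?_) hx
  cases l with
  | nil =>
    rw [word_nil, one_mul, ← mul_assoc]
    by_cases h : w = v
    · rw [h, P_mul_self]
      simpa [word_nil] using word_mem_wordSpan (E := E) [] v l'
    · rw [P_mul_ne h, zero_mul]; exact zero_mem _
  | cons e l =>
    by_cases h : w = E.s e
    · have := word_mem_wordSpan (E := E) (e :: l) v l'
      rw [word_cons] at this ⊢
      simp only [← mul_assoc] at this ⊢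
      rwa [h, P_mul_S]
    · rw [word_cons]
      simp only [← mul_assoc]
      rw [P_mul_S_ne h]
      simp

theorem S_mul_mem_wordSpan (e : Ed) {x : E.CStar} (hx : x ∈ E.wordSpan) :
    S E e * x ∈ E.wordSpan := by
  refine mul_mem_wordSpan_of (fun l v l' => ?_) hx
  have := word_mem_wordSpan (E := E) (e :: l) v l'
  rw [word_cons] at this
  simpa only [mul_assoc] using this

theorem star_S_mul_mem_wordSpan (e : Ed) {x : E.CStar} (hx : x ∈ E.wordSpan) :
    star (S E e) * x ∈ E.wordSpan := by
  refine mul_mem_wordSpan_of (fun l v l' => ?_) hx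
  cases l with
  | nil =>
    rw [word_nil, one_mul, ← mul_assoc]
    by_cases h : v = E.s e
    · have h1 : star (S E e) * P E v * star (E.word l') =
          E.word [] * P E (E.r e) * star (E.word (l' ++ [e])) := by
        have h2 : star (S E e) * P E v = P E (E.r e) * star (S E e) := by
          rw [← star_P, ← star_mul, h, P_mul_S, ← star_P, ← star_mul, S_mul_P]
        rw [h2, word_append, word_nil, one_mul, mul_assoc, ← star_mul]
        simp [word_cons, word_nil]
      rw [h1]
      exact word_mem_wordSpan _ _ _
    · rw [← star_P, ← star_mul, P_mul_S_ne h]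
      simp
  | cons f l =>
    rw [word_cons]
    simp only [← mul_assoc]
    by_cases h : e = f
    · subst h
      rw [star_S_mul_self]
      simpa only [mul_assoc] using P_mul_mem_wordSpan (E.r e) (word_mem_wordSpan (E := E) l v l')
    · rw [star_S_mul_ne h]
      simp

theorem ofPoly_mem_wordSpan (x : E.PreAlg) : ofPoly E x ∈ E.wordSpan := by
  have h1 : (1 : E.CStar) ∈ E.wordSpan := by
    rw [← sum_P]
    refine sum_mem fun v _ => ?_
    simpa [word_nil] using word_mem_wordSpan (E := E) [] v []
  have hw : ∀ w : FreeMonoid ((V ⊕ Ed) × Bool),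
      ofPoly E (FreeStarAlg.mono w 1) ∈ E.wordSpan := by
    intro w
    induction w using FreeMonoid.inductionOn' with
    | one =>
      have : ofPoly E (FreeStarAlg.mono 1 1) = 1 := map_one (ofPoly E)
      rwa [this]
    | of_mul y w ih =>
      have h2 : ofPoly E (FreeStarAlg.mono (FreeMonoid.of y * w) 1) =
          ofPoly E (FreeStarAlg.mono (FreeMonoid.of y) 1) * ofPoly E (FreeStarAlg.mono w 1) := by
        refine Eq.trans (congrArg (ofPoly E) ?_)
          (map_mul (ofPoly E) (FreeStarAlg.mono (FreeMonoid.of y) 1) (FreeStarAlg.mono w 1))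
        exact ((FreeStarAlg.mono_mul_mono (FreeMonoid.of y) w 1 1).trans (by rw [mul_one])).symm
      rw [h2]
      have hstar : ∀ g : V ⊕ Ed, ofPoly E (FreeStarAlg.mono (FreeMonoid.of (g, true)) 1) =
          star (ofPoly E (FreeStarAlg.gen g)) := fun g =>
        (congrArg (ofPoly E) (FreeStarAlg.star_gen g).symm).trans
          (star_ofPoly (E := E) (FreeStarAlg.gen g)).symm
      obtain ⟨v | e, b⟩ := y <;> cases b
      · exact P_mul_mem_wordSpan v ih
      · rw [hstar]
        change star (P E v) * _ ∈ _
        rw [star_P]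
        exact P_mul_mem_wordSpan v ih
      · exact S_mul_mem_wordSpan e ih
      · rw [hstar]
        exact star_S_mul_mem_wordSpan e ih
  refine FreeStarAlg.induction_mono (motive := fun x : FreeStarAlg (V ⊕ Ed) =>
    ofPoly E x ∈ E.wordSpan) x ?_ ?_ ?_
  · have : ofPoly E 0 = 0 := map_zero (ofPoly E)
    exact this ▸ zero_mem _
  · intro x y hx hy
    have : ofPoly E (x + y : E.PreAlg) = ofPoly E x + ofPoly E y := map_add (ofPoly E) x y
    exact this ▸ add_mem hx hy
  · intro w c
    have h : (FreeStarAlg.mono w c : FreeStarAlg (V ⊕ Ed)) = c • FreeStarAlg.mono w 1 := by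
      rw [FreeStarAlg.smul_mono, mul_one]
    have : ofPoly E (FreeStarAlg.mono w c) = c • ofPoly E (FreeStarAlg.mono w 1) := by
      rw [h]; exact map_smul (ofPoly E) c (FreeStarAlg.mono w 1)
    exact this ▸ Submodule.smul_mem _ _ (hw w)

theorem exists_wordSpan_near (x : E.CStar) {ε : ℝ} (hε : 0 < ε) :
    ∃ y ∈ E.wordSpan, ‖x - y‖ < ε := by
  obtain ⟨a, ha⟩ := (denseRange_ofPoly (E := E)).exists_dist_lt x hε
  exact ⟨ofPoly E a, ofPoly_mem_wordSpan a, by rwa [← dist_eq_norm]⟩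

/-- The elements to which monomials are compressed by long words. -/
def IsCompressed (a : E.CStar) : Prop :=
  a = 0 ∨ (∃ w, a = P E w) ∨ (∃ l, l ≠ [] ∧ a = E.word l) ∨ ∃ l, l ≠ [] ∧ a = star (E.word l)

theorem IsCompressed.star_mem {a : E.CStar} (h : IsCompressed a) : IsCompressed (star a) := by
  rcases h with rfl | ⟨w, rfl⟩ | ⟨l, hl, rfl⟩ | ⟨l, hl, rfl⟩
  · exact .inl (star_zero _)
  · exact .inr (.inl ⟨w, star_P w⟩)
  · exact .inr (.inr (.inr ⟨l, hl, rfl⟩))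
  · exact .inr (.inr (.inl ⟨l, hl, star_star _⟩))

theorem P_mul_word_cons (w : V) (e : Ed) (l : List Ed) :
    P E w * E.word (e :: l) = 0 ∨ P E w * E.word (e :: l) = E.word (e :: l) := by
  rw [word_cons, ← mul_assoc]
  by_cases h : w = E.s e
  · right; rw [h, P_mul_S]
  · left; rw [P_mul_S_ne h, zero_mul]

theorem isCompressed_star_word_mul (μ ν : List Ed) (w : V) :
    IsCompressed (star (E.word μ) * P E w * E.word ν) := by
  have hnil : ∀ (ν : List Ed) w, IsCompressed (P E w * E.word ν) := by
    rintro (_ | ⟨e, l⟩) w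
    · exact .inr (.inl ⟨w, by rw [word_nil, mul_one]⟩)
    · rcases P_mul_word_cons (E := E) w e l with h | h
      · exact .inl h
      · exact .inr (.inr (.inl ⟨_, List.cons_ne_nil _ _, h⟩))
  induction μ generalizing ν w with
  | nil => simpa [word_nil] using hnil ν w
  | cons e μ ih =>
    cases ν with
    | nil =>
      have := (hnil (e :: μ) w).star_mem
      rwa [star_mul, star_P, ← mul_one (star _ * _), ← word_nil (E := E)] at this
    | cons f ν =>
      rw [word_cons, word_cons, star_mul, mul_assoc, mul_assoc, ← mul_assoc (P E w)]
      by_cases hw : w = E.s f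
      · rw [hw, P_mul_S, ← mul_assoc (star (S E e))]
        by_cases hef : e = f
        · subst hef
          rw [star_S_mul_self, ← mul_assoc]
          exact ih ν _
        · rw [star_S_mul_ne hef, zero_mul, mul_zero]
          exact .inl rfl
      · rw [P_mul_S_ne hw, zero_mul, mul_zero, mul_zero]
        exact .inl rfl

theorem star_word_mul_word (μ l : List Ed) (v : V) (h : l.length ≤ μ.length) :
    star (E.word μ) * (E.word l * P E v) = 0 ∨
      ∃ μ', star (E.word μ) * (E.word l * P E v) = star (E.word μ') * P E v := by
  induction l generalizing μ with
  | nil => exact .inr ⟨μ, by rw [word_nil, one_mul]⟩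
  | cons e l ih =>
    cases μ with
    | nil => simp at h
    | cons f μ =>
      have h' : l.length ≤ μ.length := by simpa using h
      have h1 : star (E.word (f :: μ)) * (E.word (e :: l) * P E v) =
          star (E.word μ) * (star (S E f) * S E e * (E.word l * P E v)) := by
        rw [word_cons, word_cons, star_mul]
        simp only [mul_assoc]
      rw [h1]
      by_cases hef : f = e
      · subst hef
        rw [star_S_mul_self]
        cases l with
        | nil =>
          rw [word_nil, one_mul]
          by_cases hv : E.r f = v
          · exact .inr ⟨μ, by rw [hv, P_mul_self]⟩
          · exact .inl (by rw [P_mul_ne hv, mul_zero])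
        | cons g l =>
          rw [← mul_assoc (P E _)]
          rcases P_mul_word_cons (E := E) (E.r f) g l with h2 | h2
          · exact .inl (by rw [h2, zero_mul, mul_zero])
          · rw [h2]
            exact ih μ h'
      · exact .inl (by rw [star_S_mul_ne hef, zero_mul, mul_zero])

theorem isCompressed_of_length_le {μ ν l l' : List Ed} (v : V) (h : l.length ≤ μ.length)
    (h' : l'.length ≤ ν.length) :
    IsCompressed (star (E.word μ) * (E.word l * P E v * star (E.word l')) * E.word ν) := by
  have h1 : star (E.word μ) * (E.word l * P E v * star (E.word l')) * E.word ν =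
      star (E.word μ) * (E.word l * P E v) * star (star (E.word ν) * (E.word l' * P E v)) := by
    rw [star_mul, star_mul, star_star, star_P]
    simp only [mul_assoc]
    rw [← mul_assoc (P E v) (P E v), P_mul_self]
  rw [h1]
  rcases star_word_mul_word (E := E) μ l v h with h2 | ⟨μ', h2⟩
  · exact .inl (by rw [h2, zero_mul])
  rcases star_word_mul_word (E := E) ν l' v h' with h3 | ⟨ν', h3⟩
  · exact .inl (by rw [h3, star_zero, mul_zero])
  rw [h2, h3, star_mul, star_star, star_P, mul_assoc, ← mul_assoc (P E v) (P E v), P_mul_self,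
    ← mul_assoc]
  exact isCompressed_star_word_mul _ _ _

/-! ## Matrix coefficients of compressions -/

theorem norm_le_one_of_star_mul_self {p : E.CStar} (h : star p * p = p) : ‖p‖ ≤ 1 := by
  have h1 := CStarRing.norm_star_mul_self (x := p)
  rw [h] at h1
  nlinarith [norm_nonneg p]

theorem norm_P_le (v : V) : ‖P E v‖ ≤ 1 :=
  norm_le_one_of_star_mul_self (by rw [star_P, P_mul_self])

theorem norm_le_one_of_star_mul_self_eq_P {x : E.CStar} {v : V} (h : star x * x = P E v) :
    ‖x‖ ≤ 1 := by
  have h1 := CStarRing.norm_star_mul_self (x := x)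
  rw [h] at h1
  nlinarith [norm_nonneg x, norm_P_le (E := E) v]

theorem norm_SPath_le {n : ℕ} (μ : E.Path n) : ‖E.SPath μ‖ ≤ 1 :=
  norm_le_one_of_star_mul_self_eq_P (star_SPath_mul_self μ)

theorem norm_word_le (l : List Ed) : ‖E.word l‖ ≤ 1 := by
  induction l with
  | nil => exact norm_le_one_of_star_mul_self (by simp [word_nil])
  | cons e l ih =>
    rw [word_cons]
    exact (norm_mul_le _ _).trans (mul_le_one₀
      (norm_le_one_of_star_mul_self_eq_P (star_S_mul_self e)) (norm_nonneg _) ih)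

theorem norm_mul_mul_le {a x b : E.CStar} (ha : ‖a‖ ≤ 1) (hb : ‖b‖ ≤ 1) :
    ‖a * x * b‖ ≤ ‖x‖ := by
  refine (norm_mul_le _ _).trans ((mul_le_of_le_one_right (norm_nonneg _) hb).trans ?_)
  exact (norm_mul_le _ _).trans (mul_le_of_le_one_left (norm_nonneg _) ha)

theorem PathPerm.Represents.lam_word_mul_SPath {n : ℕ} {σ : E.PathPerm (n + 1)} {u : E.CStar}
    (h : σ.Represents u) (hU : u ∈ E.UE) (l : List Ed) (α : E.Path n) :
    lam u hU (E.word l) * E.SPath α = 0 ∨ ∃ (β : E.Path n) (l' : List Ed),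
      l'.length = l.length ∧ lam u hU (E.word l) * E.SPath α = E.SPath β * E.word l' := by
  induction l with
  | nil => exact .inr ⟨α, [], rfl, by rw [word_nil, map_one, one_mul, mul_one]⟩
  | cons e l ih =>
    rw [word_cons, map_mul, mul_assoc]
    rcases ih with ih | ⟨β, l', hl, ih⟩
    · exact .inl (by rw [ih, mul_zero])
    · rw [ih, ← mul_assoc]
      by_cases hβ : β.src = E.r e
      · rw [h.lam_S_mul_SPath hU e β hβ, SPath_eq_init_last]
        exact .inr ⟨_, (σ.toPerm (β.cons e hβ)).last :: l', by simp [hl], by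
          rw [word_cons, mul_assoc]⟩
      · exact .inl (by rw [lam_S_mul_SPath_ne hU hβ, zero_mul])

/-- The functionals of `CStar.exists_functional`. -/
structure IsVertexState (ω : V → E.CStar →L[ℂ] ℂ) : Prop where
  norm_le : ∀ v a, ‖ω v a‖ ≤ ‖a‖
  map_star : ∀ v a, ω v (star a) = star (ω v a)
  map_P : ∀ v, ω v (P E v) = 1
  map_word : ∀ v l, l ≠ [] → ω v (E.word l) = 0

theorem NoSinks.exists_isVertexState (h : E.NoSinks) :
    ∃ ω : V → E.CStar →L[ℂ] ℂ, IsVertexState ω := by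
  choose ω h1 h2 h3 h4 using CStar.exists_functional h
  exact ⟨ω, h1, h2, h3, h4⟩

open Classical in
theorem IsCompressed.exists_coeff {n : ℕ} {σ : E.PathPerm (n + 1)} {u : E.CStar}
    (h : σ.Represents u) (hU : u ∈ E.UE) {ω : V → E.CStar →L[ℂ] ℂ} (hω : IsVertexState ω)
    {a : E.CStar} (ha : IsCompressed a) : ∃ c : V → ℂ, ∀ α β : E.Path n,
      ω α.rng (star (E.SPath α) * lam u hU a * E.SPath β) = if α = β then c α.src else 0 := by
  have hword : ∀ l, l ≠ [] → ∀ (v : V) (α β : E.Path n),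
      ω v (star (E.SPath α) * lam u hU (E.word l) * E.SPath β) = 0 := by
    intro l hl v α β
    rw [mul_assoc]
    rcases h.lam_word_mul_SPath hU l β with h1 | ⟨γ, l', hl', h1⟩
    · rw [h1, mul_zero, map_zero]
    · rw [h1, ← mul_assoc]
      by_cases hαγ : α = γ
      · rw [hαγ, star_SPath_mul_self]
        cases l' with
        | nil => exact absurd (List.length_eq_zero_iff.1 hl'.symm) hl
        | cons e l' =>
          rcases P_mul_word_cons (E := E) γ.rng e l' with h2 | h2
          · rw [h2, map_zero]
          · rw [h2, hω.map_word _ _ (List.cons_ne_nil _ _)]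
      · rw [star_SPath_mul_ne hαγ, zero_mul, map_zero]
  rcases ha with rfl | ⟨w, rfl⟩ | ⟨l, hl, rfl⟩ | ⟨l, hl, rfl⟩
  · exact ⟨fun _ => 0, fun α β => by simp⟩
  · refine ⟨fun v => if w = v then 1 else 0, fun α β => ?_⟩
    rw [lam_P, mul_assoc]
    by_cases hw : w = β.src
    · rw [hw, P_mul_SPath]
      by_cases h1 : α = β
      · rw [h1, star_SPath_mul_self, hω.map_P, if_pos rfl]
        exact (if_pos rfl).symm
      · rw [star_SPath_mul_ne h1, map_zero, if_neg h1]
    · rw [P_mul_SPath_ne hw, mul_zero, map_zero]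
      by_cases h1 : α = β
      · rw [if_pos h1, h1]
        exact (if_neg hw).symm
      · rw [if_neg h1]
  · exact ⟨fun _ => 0, fun α β => by rw [hword l hl]; simp⟩
  · refine ⟨fun _ => 0, fun α β => ?_⟩
    have h1 : star (E.SPath α) * lam u hU (star (E.word l)) * E.SPath β =
        star (star (E.SPath β) * lam u hU (E.word l) * E.SPath α) := by
      simp only [star_mul, star_star, map_star, mul_assoc]
    rw [h1, hω.map_star, hword l hl]
    simp

open Classical in
theorem exists_coeff_of_mem_wordSpan {n : ℕ} {σ : E.PathPerm (n + 1)} {u : E.CStar}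
    (h : σ.Represents u) (hU : u ∈ E.UE) {ω : V → E.CStar →L[ℂ] ℂ} (hω : IsVertexState ω)
    {x : E.CStar} (hx : x ∈ E.wordSpan) : ∃ N : ℕ, ∀ μ ν : List Ed, N ≤ μ.length → N ≤ ν.length →
      ∃ c : V → ℂ, ∀ α β : E.Path n,
        ω α.rng (star (E.SPath α) * lam u hU (star (E.word μ) * x * E.word ν) * E.SPath β) =
          if α = β then c α.src else 0 := by
  induction hx using Submodule.span_induction with
  | mem x hx =>
    obtain ⟨⟨l, v, l'⟩, rfl⟩ := hx
    exact ⟨max l.length l'.length, fun μ ν hμ hν =>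
      (isCompressed_of_length_le v ((le_max_left _ _).trans hμ)
        ((le_max_right _ _).trans hν)).exists_coeff h hU hω⟩
  | zero => exact ⟨0, fun μ ν _ _ => ⟨fun _ => 0, fun α β => by simp⟩⟩
  | add x y _ _ hx hy =>
    obtain ⟨N, hN⟩ := hx
    obtain ⟨M, hM⟩ := hy
    refine ⟨max N M, fun μ ν hμ hν => ?_⟩
    obtain ⟨c, hc⟩ := hN μ ν ((le_max_left _ _).trans hμ) ((le_max_left _ _).trans hν)
    obtain ⟨d, hd⟩ := hM μ ν ((le_max_right _ _).trans hμ) ((le_max_right _ _).trans hν)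
    refine ⟨fun v => c v + d v, fun α β => ?_⟩
    rw [mul_add, add_mul, map_add, mul_add, add_mul, map_add, hc, hd]
    split_ifs <;> simp
  | smul k x _ hx =>
    obtain ⟨N, hN⟩ := hx
    refine ⟨N, fun μ ν hμ hν => ?_⟩
    obtain ⟨c, hc⟩ := hN μ ν hμ hν
    refine ⟨fun v => k * c v, fun α β => ?_⟩
    rw [mul_smul_comm, smul_mul_assoc, map_smul, mul_smul_comm, smul_mul_assoc, map_smul, hc]
    split_ifs <;> simp

open Classical in
theorem exists_coeff_near {n : ℕ} {σ : E.PathPerm (n + 1)} {u : E.CStar}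
    (h : σ.Represents u) (hU : u ∈ E.UE) {ω : V → E.CStar →L[ℂ] ℂ} (hω : IsVertexState ω)
    (x : E.CStar) {ε : ℝ} (hε : 0 < ε) :
    ∃ N : ℕ, ∀ μ ν : List Ed, N ≤ μ.length → N ≤ ν.length →
      ∃ c : V → ℂ, ∀ α β : E.Path n,
        ‖ω α.rng (star (E.SPath α) * lam u hU (star (E.word μ) * x * E.word ν) * E.SPath β) -
          if α = β then c α.src else 0‖ < ε := by
  obtain ⟨y, hy, hxy⟩ := exists_wordSpan_near x hε
  obtain ⟨N, hN⟩ := exists_coeff_of_mem_wordSpan h hU hω hy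
  refine ⟨N, fun μ ν hμ hν => ?_⟩
  obtain ⟨c, hc⟩ := hN μ ν hμ hν
  refine ⟨c, fun α β => lt_of_le_of_lt ?_ hxy⟩
  rw [← hc, ← map_sub, ← sub_mul, ← mul_sub, ← map_sub, ← sub_mul, ← mul_sub]
  refine (hω.norm_le _ _).trans ((norm_mul_mul_le ?_ (norm_SPath_le β)).trans
    ((NonUnitalStarAlgHom.norm_apply_le (lam u hU) _).trans (norm_mul_mul_le ?_ (norm_word_le ν))))
  · rw [norm_star]; exact norm_SPath_le α
  · rw [norm_star]; exact norm_word_le μ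

/-! ## Surjectivity implies acyclicity -/

/-- The word `μ` transports the path `α` to the path `β`, followed by the word `h`. -/
def Transports (u : E.CStar) (hU : u ∈ E.UE) {n : ℕ} (μ h : List Ed) (α β : E.Path n) : Prop :=
  lam u hU (E.word μ) * E.SPath α = E.SPath β * E.word h ∧
    star (E.word h) * P E β.rng * E.word h = P E α.rng

theorem Transports.trans {u : E.CStar} {hU : u ∈ E.UE} {n : ℕ} {μ μ' h h' : List Ed}
    {α β γ : E.Path n} (h1 : Transports u hU μ h α β) (h2 : Transports u hU μ' h' β γ) :
    Transports u hU (μ' ++ μ) (h' ++ h) α γ := by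
  constructor
  · rw [word_append, word_append, map_mul, mul_assoc, h1.1, ← mul_assoc, h2.1, mul_assoc]
  · rw [← h1.2, ← h2.2, word_append, star_mul]
    simp only [mul_assoc]

theorem PathPerm.Represents.transports {n : ℕ} {σ : E.PathPerm (n + 1)} {u : E.CStar}
    (h : σ.Represents u) (hU : u ∈ E.UE) (e : Ed) (α : E.Path n) (hα : α.src = E.r e) :
    Transports u hU [e] [(σ.toPerm (α.cons e hα)).last] α (σ.toPerm (α.cons e hα)).init := by
  constructor
  · rw [word_cons, word_cons, word_nil, mul_one, mul_one, h.lam_S_mul_SPath hU e α hα,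
      SPath_eq_init_last]
  · rw [word_cons, word_nil, mul_one, mul_assoc, ← Path.s_last, P_mul_S, star_S_mul_self,
      ← Path.rng_eq_last, σ.rng_eq, Path.rng_cons]

theorem Transports.compress {u : E.CStar} {hU : u ∈ E.UE} {n : ℕ} {μ ν h h' : List Ed}
    {α β α' β' : E.Path n} (h1 : Transports u hU μ h α α') (h2 : Transports u hU ν h' β β')
    (x : E.CStar) : star (E.SPath α) * lam u hU (star (E.word μ) * x * E.word ν) * E.SPath β =
      star (E.word h) * (star (E.SPath α') * lam u hU x * E.SPath β') * E.word h' := by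
  have h3 : star (E.SPath α) * lam u hU (star (E.word μ) * x * E.word ν) * E.SPath β =
      star (lam u hU (E.word μ) * E.SPath α) * lam u hU x * (lam u hU (E.word ν) * E.SPath β) := by
    rw [map_mul, map_mul, map_star, star_mul]
    simp only [mul_assoc]
  rw [h3, h1.1, h2.1, star_mul]
  simp only [mul_assoc]

/-- The relation defining the first order condition. -/
def PathPerm.DiagonalStep {n : ℕ} (σ : E.PathPerm (n + 1)) (p q : PathPerm.SrcPairs E n) : Prop :=
  ∃ (e : Ed) (α β : {α : E.Path n // α.src = E.r e}), α ≠ β ∧ p = PathPerm.srcPair α β ∧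
    q = PathPerm.srcPair (σ.f e α) (σ.f e β)

theorem exists_le_of_comp {X : ℕ → Prop} (h1 : ∃ m, 1 ≤ m ∧ X m)
    (h2 : ∀ m k, X m → X k → X (m + k)) (N : ℕ) : ∃ m, N ≤ m ∧ X m := by
  obtain ⟨k, hk, hX⟩ := h1
  induction N with
  | zero => exact ⟨k, Nat.zero_le _, hX⟩
  | succ N ih =>
    obtain ⟨m, hm, hXm⟩ := ih
    exact ⟨m + k, by omega, h2 m k hXm hX⟩

theorem PathPerm.Represents.diagonalStep_acyclic {n : ℕ} {σ : E.PathPerm (n + 1)} {u : E.CStar}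
    (h : σ.Represents u) (hU : u ∈ E.UE) (hsink : E.NoSinks)
    (hs : Function.Surjective (lam u hU)) (p : PathPerm.SrcPairs E n) :
    ¬ Relation.TransGen σ.DiagonalStep p p := by
  intro hp
  have hne : p.1.1 ≠ p.1.2 := by
    obtain ⟨q, ⟨e, α, β, hαβ, rfl, -⟩, -⟩ := Relation.TransGen.head'_iff.1 hp
    exact fun h' => hαβ (Subtype.ext h')
  have htr : ∀ q, Relation.TransGen σ.DiagonalStep p q → ∃ μ k k' : List Ed, 1 ≤ μ.length ∧
      Transports u hU μ k p.1.1 q.1.1 ∧ Transports u hU μ k' p.1.2 q.1.2 := by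
    have hstep : ∀ p q, σ.DiagonalStep p q → ∃ μ k k' : List Ed, 1 ≤ μ.length ∧
        Transports u hU μ k p.1.1 q.1.1 ∧ Transports u hU μ k' p.1.2 q.1.2 := by
      rintro _ _ ⟨e, α, β, -, rfl, rfl⟩
      exact ⟨[e], _, _, le_rfl, h.transports hU e α.1 α.2, h.transports hU e β.1 β.2⟩
    intro q hq
    induction hq with
    | single hq => exact hstep _ _ hq
    | tail _ hq ih =>
      obtain ⟨μ, k, k', hμ, h1, h2⟩ := ih
      obtain ⟨ν, l, l', hν, h3, h4⟩ := hstep _ _ hq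
      exact ⟨_, _, _, by rw [List.length_append]; omega, h1.trans h3, h2.trans h4⟩
  obtain ⟨ω, hω⟩ := hsink.exists_isVertexState
  obtain ⟨x, hx⟩ := hs (E.SPath p.1.1 * star (E.SPath p.1.1))
  obtain ⟨N, hN⟩ := exists_coeff_near h hU hω x (ε := 1 / 2) (by norm_num)
  obtain ⟨m, hm, μ, k, k', hμ, h1, h2⟩ := exists_le_of_comp
    (X := fun m => ∃ μ k k' : List Ed, m ≤ μ.length ∧
      Transports u hU μ k p.1.1 p.1.1 ∧ Transports u hU μ k' p.1.2 p.1.2)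
    (by
      obtain ⟨μ, k, k', hμ⟩ := htr p hp
      exact ⟨1, le_rfl, μ, k, k', hμ⟩)
    (by
      rintro m j ⟨μ, k, k', hμ, h1, h2⟩ ⟨ν, l, l', hν, h3, h4⟩
      exact ⟨_, _, _, by rw [List.length_append]; omega, h1.trans h3, h2.trans h4⟩) N
  obtain ⟨c, hc⟩ := hN μ μ (hm.trans hμ) (hm.trans hμ)
  have hc1 := hc p.1.1 p.1.1
  have hc2 := hc p.1.2 p.1.2
  rw [if_pos rfl, h1.compress h1, hx, ← mul_assoc (star (E.SPath p.1.1)), star_SPath_mul_self,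
    mul_assoc (P E _), star_SPath_mul_self, P_mul_self, h1.2, hω.map_P] at hc1
  rw [if_pos rfl, h2.compress h2, hx, ← mul_assoc (star (E.SPath p.1.2)),
    star_SPath_mul_ne (Ne.symm hne), zero_mul, zero_mul, mul_zero, zero_mul, map_zero,
    ← p.2, zero_sub, norm_neg] at hc2
  have h3 : ‖(1 : ℂ)‖ ≤ ‖1 - c p.1.1.src‖ + ‖c p.1.1.src‖ := by
    simpa using norm_add_le (1 - c p.1.1.src) (c p.1.1.src)
  rw [norm_one] at h3
  linarith

theorem PathPerm.Represents.pairMap_acyclic {n : ℕ} {σ : E.PathPerm (n + 1)} {u : E.CStar}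
    (h : σ.Represents u) (hU : u ∈ E.UE) (hsink : E.NoSinks)
    (hs : Function.Surjective (lam u hU)) (p : PathPerm.Psi E n) :
    ¬ Relation.TransGen (fun p q => ∃ e g, σ.PairMap e g p q) p p := by
  intro hp
  have hstep : ∀ p q, (∃ e g, σ.PairMap e g p q) → p.1.1.rng = p.1.2.rng ∧
      ∃ μ ν k : List Ed, (1 ≤ μ.length ∧ 1 ≤ ν.length) ∧
        Transports u hU μ k p.1.1 q.1.1 ∧ Transports u hU ν k p.1.2 q.1.2 := by
    rintro p q ⟨e, g, hα, hβ, h1, h2, h3⟩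
    have h4 := h.transports hU e _ hα
    have h5 := h.transports hU g _ hβ
    rw [h1] at h4
    rw [h2, ← h3] at h5
    refine ⟨?_, [e], [g], _, ⟨le_rfl, le_rfl⟩, h4, h5⟩
    rw [← Path.rng_cons e _ hα, ← Path.rng_cons g _ hβ, ← σ.rng_eq (Path.cons e _ hα),
      ← σ.rng_eq (Path.cons g _ hβ), Path.rng_eq_last, h3, ← Path.rng_eq_last]
  have hrng : p.1.1.rng = p.1.2.rng := by
    obtain ⟨q, hq, -⟩ := Relation.TransGen.head'_iff.1 hp
    exact (hstep _ _ hq).1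
  have htr : ∀ q, Relation.TransGen (fun p q => ∃ e g, σ.PairMap e g p q) p q →
      ∃ μ ν k : List Ed, (1 ≤ μ.length ∧ 1 ≤ ν.length) ∧
        Transports u hU μ k p.1.1 q.1.1 ∧ Transports u hU ν k p.1.2 q.1.2 := by
    intro q hq
    induction hq with
    | single hq => exact (hstep _ _ hq).2
    | tail _ hq ih =>
      obtain ⟨μ, ν, k, hμ, h1, h2⟩ := ih
      obtain ⟨μ', ν', k', hμ', h3, h4⟩ := (hstep _ _ hq).2
      refine ⟨_, _, _, ⟨?_, ?_⟩, h1.trans h3, h2.trans h4⟩ <;> rw [List.length_append] <;> omega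
  obtain ⟨ω, hω⟩ := hsink.exists_isVertexState
  obtain ⟨x, hx⟩ := hs (E.SPath p.1.1 * star (E.SPath p.1.2))
  obtain ⟨N, hN⟩ := exists_coeff_near h hU hω x (ε := 1) one_pos
  obtain ⟨m, hm, μ, ν, k, hμ, h1, h2⟩ := exists_le_of_comp
    (X := fun m => ∃ μ ν k : List Ed, (m ≤ μ.length ∧ m ≤ ν.length) ∧
      Transports u hU μ k p.1.1 p.1.1 ∧ Transports u hU ν k p.1.2 p.1.2)
    (by
      obtain ⟨μ, ν, k, hμ⟩ := htr p hp
      exact ⟨1, le_rfl, μ, ν, k, hμ⟩)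
    (by
      rintro m j ⟨μ, ν, k, hμ, h1, h2⟩ ⟨μ', ν', k', hμ', h3, h4⟩
      refine ⟨_, _, _, ⟨?_, ?_⟩, h1.trans h3, h2.trans h4⟩ <;> rw [List.length_append] <;> omega) N
  obtain ⟨c, hc⟩ := hN μ ν (hm.trans hμ.1) (hm.trans hμ.2)
  have hc1 := hc p.1.1 p.1.2
  rw [if_neg p.2, h1.compress h2, hx, ← mul_assoc (star (E.SPath p.1.1)), star_SPath_mul_self,
    mul_assoc (P E _), star_SPath_mul_self, ← hrng, P_mul_self, h1.2, hω.map_P, sub_zero,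
    norm_one] at hc1
  exact lt_irrefl _ hc1

theorem PathPerm.Represents.diagonalOrderCondition {n : ℕ} {σ : E.PathPerm (n + 1)} {u : E.CStar}
    (h : σ.Represents u) (hU : u ∈ E.UE) (hsink : E.NoSinks)
    (hs : Function.Surjective (lam u hU)) : σ.DiagonalOrderCondition := by
  obtain ⟨o, h1, h2⟩ := exists_partialOrder_of_acyclic σ.DiagonalStep
    (h.diagonalStep_acyclic hU hsink hs)
  refine ⟨o, fun p => (h1 p).trans ⟨fun hp => ?_, ?_⟩, fun e α β hαβ =>
    h2 _ _ ⟨e, α, β, hαβ, rfl, rfl⟩⟩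
  · by_contra! hne
    obtain ⟨⟨e, he⟩, hne⟩ := hne
    exact hp _ ⟨e, ⟨p.1.1, he.symm⟩, ⟨p.1.2, p.2.symm.trans he.symm⟩,
      fun h' => hne (congrArg Subtype.val h'), rfl, rfl⟩
  · rintro hp q ⟨e, α, β, hαβ, rfl, -⟩
    rcases hp with hp | hp
    · exact hp e α.2.symm
    · exact hαβ (Subtype.ext hp)

theorem PathPerm.Represents.offDiagonalOrderCondition {n : ℕ} {σ : E.PathPerm (n + 1)}
    {u : E.CStar} (h : σ.Represents u) (hU : u ∈ E.UE) (hsink : E.NoSinks)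
    (hs : Function.Surjective (lam u hU)) : σ.OffDiagonalOrderCondition := by
  obtain ⟨o, h1, h2⟩ := exists_partialOrder_of_acyclic _ (h.pairMap_acyclic hU hsink hs)
  refine ⟨o, Set.ext fun p => (h1 p).trans ?_, fun e g p q hpq => h2 p q ⟨e, g, hpq⟩⟩
  constructor
  · rintro hp ⟨e, g, q, hpq⟩
    exact hp q ⟨e, g, hpq⟩
  · rintro hp q ⟨e, g, hpq⟩
    exact hp ⟨e, g, q, hpq⟩

end DirGraph

end

noncomputable section

namespace DirGraph

variable {V Ed : Type*} {E : DirGraph V Ed} [Fintype V] [Fintype Ed]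

open CStar

/-! ## The algebraic core -/

/-- The algebraic core of `C*(E)`: the smallest `*`-subring that contains the vertex projections
and is closed under `x ↦ S_e x S_g^*`. -/
inductive IsCore : E.CStar → Prop
  | vertex (v : V) : IsCore (P E v)
  | zero : IsCore 0
  | add {x y : E.CStar} : IsCore x → IsCore y → IsCore (x + y)
  | mul {x y : E.CStar} : IsCore x → IsCore y → IsCore (x * y)
  | star {x : E.CStar} : IsCore x → IsCore (star x)
  | sandwich (e g : Ed) {x : E.CStar} : IsCore x → IsCore (S E e * x * Star.star (S E g))

theorem IsCore.sum {ι : Type*} {s : Finset ι} {f : ι → E.CStar} (h : ∀ i ∈ s, IsCore (f i)) :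
    IsCore (∑ i ∈ s, f i) :=
  Finset.sum_induction f IsCore (fun _ _ => IsCore.add) IsCore.zero h

theorem IsCore.one : IsCore (1 : E.CStar) := by
  rw [← sum_P]
  exact IsCore.sum fun v _ => IsCore.vertex v

theorem isCore_SPath {n : ℕ} (α β : E.Path n) : IsCore (E.SPath α * star (E.SPath β)) := by
  induction n with
  | zero =>
    obtain ⟨v, l, hl, hw⟩ := α
    obtain rfl := List.length_eq_zero_iff.1 hl
    obtain ⟨w, l, hl, hw⟩ := β
    obtain rfl := List.length_eq_zero_iff.1 hl
    rw [SPath_eq, SPath_eq]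
    change IsCore ((P E v * 1) * star (P E w * 1))
    rw [mul_one, mul_one]
    exact (IsCore.vertex v).mul (IsCore.vertex w).star
  | succ n ih =>
    obtain ⟨e, α, hα, rfl⟩ := α.exists_cons
    obtain ⟨g, β, hβ, rfl⟩ := β.exists_cons
    have := IsCore.sandwich e g (ih α β)
    rw [SPath_cons, SPath_cons, star_mul]
    simpa only [mul_assoc] using this

variable (E) in
/-- The canonical shift `x ↦ ∑ S_e x S_e^*`. -/
def shift (a : E.CStar) : E.CStar := ∑ e, S E e * a * star (S E e)

theorem shift_mul_S {a : E.CStar} (ha : ∀ v, a * P E v = P E v * a) (e : Ed) :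
    E.shift a * S E e = S E e * a := by
  rw [shift, Finset.sum_mul, Finset.sum_eq_single e]
  · rw [mul_assoc, star_S_mul_self, mul_assoc, ha, ← mul_assoc, S_mul_P]
  · intro f _ hf
    rw [mul_assoc, star_S_mul_ne hf, mul_zero]
  · simp

theorem star_shift (a : E.CStar) : star (E.shift a) = E.shift (star a) := by
  simp only [shift, star_sum, star_mul, star_star, mul_assoc]

theorem shift_mul {a : E.CStar} (ha : ∀ v, a * P E v = P E v * a) (b : E.CStar) :
    E.shift a * E.shift b = E.shift (a * b) := by
  rw [shift.eq_def E b, Finset.mul_sum]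
  exact Finset.sum_congr rfl fun e _ => by
    rw [← mul_assoc, ← mul_assoc, shift_mul_S ha, mul_assoc (S E e)]

theorem NoSinks.shift_one (h : E.NoSinks) : E.shift 1 = 1 := by
  simp only [shift, mul_one, h.sum_S]

theorem star_comm_P {u : E.CStar} (hu : ∀ v, u * P E v = P E v * u) (v : V) :
    star u * P E v = P E v * star u := by
  have := congrArg star (hu v)
  rw [star_mul, star_mul, star_P] at this
  exact this.symm

theorem NoSinks.shift_mem_UE (h : E.NoSinks) {a : E.CStar} (ha : a ∈ E.UE) :
    E.shift a ∈ E.UE := by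
  obtain ⟨⟨h1, h2⟩, hc⟩ := ha
  refine ⟨⟨?_, ?_⟩, fun v => ?_⟩
  · rw [star_shift, shift_mul (star_comm_P hc), h1, h.shift_one]
  · rw [star_shift, shift_mul hc, h2, h.shift_one]
  · rw [shift, Finset.sum_mul, Finset.mul_sum]
    refine Finset.sum_congr rfl fun e _ => ?_
    have hs : star (S E e) * P E v = star (P E v * S E e) := by rw [star_mul, star_P]
    rw [mul_assoc, hs, ← mul_assoc, ← mul_assoc]
    by_cases hv : v = E.s e
    · rw [hv, P_mul_S]
    · rw [P_mul_S_ne hv]; simp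

theorem one_mem_UE : (1 : E.CStar) ∈ E.UE := ⟨one_mem _, fun v => by rw [one_mul, mul_one]⟩

theorem mul_mem_UE {a b : E.CStar} (ha : a ∈ E.UE) (hb : b ∈ E.UE) : a * b ∈ E.UE :=
  ⟨mul_mem ha.1 hb.1, fun v => by rw [mul_assoc, hb.2, ← mul_assoc, ha.2, mul_assoc]⟩

/-- The cocycle `u φ(u) ⋯ φ^{m-1}(u)` of the shift `φ`. -/
def cocycle (u : E.CStar) : ℕ → E.CStar
  | 0 => 1
  | m + 1 => u * E.shift (cocycle u m)

theorem NoSinks.cocycle_mem_UE (h : E.NoSinks) {u : E.CStar} (hu : u ∈ E.UE) (m : ℕ) :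
    cocycle u m ∈ E.UE := by
  induction m with
  | zero => exact one_mem_UE
  | succ m ih => exact mul_mem_UE hu (h.shift_mem_UE ih)

/-- On the core, `λ_u` is eventually implemented by the cocycle of `u`. -/
theorem IsCore.exists_lam_eq (hsink : E.NoSinks) {u : E.CStar} (hU : u ∈ E.UE) {x : E.CStar}
    (hx : IsCore x) :
    ∃ N, ∀ m, N ≤ m → lam u hU x = cocycle u m * x * Star.star (cocycle u m) := by
  have hc := fun m => hsink.cocycle_mem_UE hU m
  induction hx with
  | vertex v =>
    exact ⟨0, fun m _ => by rw [lam_P, (hc m).2, mul_assoc, (hc m).1.2, mul_one]⟩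
  | zero => exact ⟨0, fun m _ => by simp⟩
  | add _ _ hx hy =>
    obtain ⟨N, hN⟩ := hx
    obtain ⟨M, hM⟩ := hy
    refine ⟨max N M, fun m hm => ?_⟩
    rw [map_add, hN m ((le_max_left _ _).trans hm), hM m ((le_max_right _ _).trans hm), mul_add,
      add_mul]
  | @mul x y _ _ hx hy =>
    obtain ⟨N, hN⟩ := hx
    obtain ⟨M, hM⟩ := hy
    refine ⟨max N M, fun m hm => ?_⟩
    rw [map_mul, hN m ((le_max_left _ _).trans hm), hM m ((le_max_right _ _).trans hm)]
    calc cocycle u m * x * Star.star (cocycle u m) * (cocycle u m * y * Star.star (cocycle u m))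
        = cocycle u m * x * (Star.star (cocycle u m) * cocycle u m) * y *
          Star.star (cocycle u m) := by simp only [mul_assoc]
      _ = _ := by rw [(hc m).1.1, mul_one]; simp only [mul_assoc]
  | star _ hx =>
    obtain ⟨N, hN⟩ := hx
    refine ⟨N, fun m hm => ?_⟩
    rw [map_star, hN m hm]
    simp only [star_mul, star_star, mul_assoc]
  | @sandwich e g x _ hx =>
    obtain ⟨N, hN⟩ := hx
    refine ⟨N + 1, fun m hm => ?_⟩
    obtain ⟨m, rfl⟩ := Nat.exists_eq_add_of_le' (Nat.one_le_of_lt hm)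
    have h1 : ∀ e, cocycle u (m + 1) * S E e = u * S E e * cocycle u m := fun e => by
      rw [cocycle, mul_assoc, shift_mul_S (hc m).2, mul_assoc]
    have h2 : cocycle u (m + 1) * (S E e * x * Star.star (S E g)) *
        Star.star (cocycle u (m + 1)) =
        (cocycle u (m + 1) * S E e) * x * Star.star (cocycle u (m + 1) * S E g) := by
      rw [star_mul]; simp only [mul_assoc]
    rw [h2, h1, h1, map_mul, map_mul, map_star, lam_S, lam_S, hN m (by omega),
      star_mul (u * S E g)]
    simp only [mul_assoc]

theorem IsCore.lam_injOn (hsink : E.NoSinks) {u : E.CStar} (hU : u ∈ E.UE) {x y : E.CStar}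
    (hx : IsCore x) (hy : IsCore y) (h : lam u hU x = lam u hU y) : x = y := by
  obtain ⟨N, hN⟩ := hx.exists_lam_eq hsink hU
  obtain ⟨M, hM⟩ := hy.exists_lam_eq hsink hU
  obtain ⟨h1, -⟩ := hsink.cocycle_mem_UE hU (max N M)
  rw [hN (max N M) (le_max_left _ _), hM (max N M) (le_max_right _ _)] at h
  have h2 := congrArg (fun z => Star.star (cocycle u (max N M)) * z * cocycle u (max N M)) h
  simp only [mul_assoc, h1.1, mul_one] at h2
  simpa only [← mul_assoc, h1.1, one_mul] using h2

theorem IsCore.lam {w : E.CStar} (hW : w ∈ E.UE) (hw : IsCore w) {x : E.CStar} (hx : IsCore x) :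
    IsCore (lam w hW x) := by
  induction hx with
  | vertex v => rw [lam_P]; exact .vertex v
  | zero => rw [map_zero]; exact .zero
  | add _ _ hx hy => rw [map_add]; exact hx.add hy
  | mul _ _ hx hy => rw [map_mul]; exact hx.mul hy
  | star _ hx => rw [map_star]; exact hx.star
  | sandwich e g _ hx =>
    rw [map_mul, map_mul, map_star, lam_S, lam_S]
    have := (hw.mul (IsCore.sandwich e g hx)).mul hw.star
    simpa only [mul_assoc, star_mul] using this

/-- If `u` lies in the core and `u^*` in the image of the core, then `λ_u` is bijective. -/
theorem IsCore.lam_bijective (hsink : E.NoSinks) {u : E.CStar} (hU : u ∈ E.UE) (hu : IsCore u)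
    {w : E.CStar} (hw : IsCore w) (h : DirGraph.lam u hU w = Star.star u) :
    Function.Bijective (DirGraph.lam u hU) := by
  have hinj : ∀ {x y : E.CStar}, IsCore x → IsCore y →
      DirGraph.lam u hU x = DirGraph.lam u hU y → x = y := fun hx hy => hx.lam_injOn hsink hU hy
  have hW : w ∈ E.UE := by
    refine ⟨⟨?_, ?_⟩, fun v => ?_⟩
    · exact hinj (hw.star.mul hw) .one (by rw [map_mul, map_star, h, star_star, hU.1.2, map_one])
    · exact hinj (hw.mul hw.star) .one (by rw [map_mul, map_star, h, star_star, hU.1.1, map_one])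
    · exact hinj (hw.mul (.vertex v)) ((IsCore.vertex v).mul hw)
        (by rw [map_mul, map_mul, h, lam_P, star_comm_P hU.2])
  have h1 : (DirGraph.lam u hU).comp (DirGraph.lam w hW) = StarAlgHom.id ℂ E.CStar := by
    refine CStar.hom_ext (fun v => ?_) fun e => ?_
    · change DirGraph.lam u hU (DirGraph.lam w hW (P E v)) = P E v
      rw [lam_P, lam_P]
    · change DirGraph.lam u hU (DirGraph.lam w hW (S E e)) = S E e
      rw [lam_S, map_mul, h, lam_S, ← mul_assoc, hU.1.1, one_mul]
  have h1' : ∀ x, DirGraph.lam u hU (DirGraph.lam w hW x) = x := fun x => DFunLike.congr_fun h1 x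
  have h2 : DirGraph.lam w hW u * w = 1 :=
    hinj ((IsCore.lam hW hw hu).mul hw) .one (by rw [map_mul, h1', h, hU.1.2, map_one])
  have h3 : (DirGraph.lam w hW).comp (DirGraph.lam u hU) = StarAlgHom.id ℂ E.CStar := by
    refine CStar.hom_ext (fun v => ?_) fun e => ?_
    · change DirGraph.lam w hW (DirGraph.lam u hU (P E v)) = P E v
      rw [lam_P, lam_P]
    · change DirGraph.lam w hW (DirGraph.lam u hU (S E e)) = S E e
      rw [lam_S, map_mul, lam_S, ← mul_assoc, h2, one_mul]
  exact Function.bijective_iff_has_inverse.2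
    ⟨DirGraph.lam w hW, fun x => DFunLike.congr_fun h3 x, h1'⟩

/-! ## The order conditions imply bijectivity -/

/-- The image of the core under `λ_u`. -/
def IsLamCore (u : E.CStar) (hU : u ∈ E.UE) (x : E.CStar) : Prop :=
  ∃ y, IsCore y ∧ lam u hU y = x

theorem IsLamCore.sum {u : E.CStar} {hU : u ∈ E.UE} {ι : Type*} {s : Finset ι} {f : ι → E.CStar}
    (h : ∀ i ∈ s, IsLamCore u hU (f i)) : IsLamCore u hU (∑ i ∈ s, f i) := by
  refine Finset.sum_induction f (IsLamCore u hU) ?_ ⟨0, .zero, map_zero _⟩ h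
  rintro _ _ ⟨x, hx, rfl⟩ ⟨y, hy, rfl⟩
  exact ⟨x + y, hx.add hy, map_add _ _ _⟩

theorem IsLamCore.sandwich {u : E.CStar} {hU : u ∈ E.UE} {x : E.CStar} (h : IsLamCore u hU x)
    (e g : Ed) : IsLamCore u hU (lam u hU (S E e) * x * star (lam u hU (S E g))) := by
  obtain ⟨y, hy, rfl⟩ := h
  exact ⟨_, hy.sandwich e g, by rw [map_mul, map_mul, map_star]⟩

open Classical in
/-- The sum of the range projections of the paths in a set. -/
def rangeSum {n : ℕ} (A : Set (E.Path n)) : E.CStar :=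
  ∑ α, if α ∈ A then E.SPath α * star (E.SPath α) else 0

open Classical in
theorem rangeSum_mul_SPath {n : ℕ} (A : Set (E.Path n)) (β : E.Path n) :
    rangeSum A * E.SPath β = if β ∈ A then E.SPath β else 0 := by
  rw [rangeSum, Finset.sum_mul, Finset.sum_eq_single β]
  · split_ifs
    · rw [mul_assoc, star_SPath_mul_self, SPath_mul_P]
    · rw [zero_mul]
  · intro α _ hα
    split_ifs
    · rw [mul_assoc, star_SPath_mul_ne hα, mul_zero]
    · rw [zero_mul]
  · simp

/-- The preimage of a set of paths under the map `f_e`. -/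
def PathPerm.preimage {n : ℕ} (σ : E.PathPerm (n + 1)) (e : Ed) (A : Set (E.Path n)) :
    Set (E.Path n) :=
  {α | ∃ h : α.src = E.r e, (σ.toPerm (α.cons e h)).init ∈ A}

theorem PathPerm.Represents.rangeSum_eq {n : ℕ} {σ : E.PathPerm (n + 1)} {u : E.CStar}
    (h : σ.Represents u) (hU : u ∈ E.UE) (hsink : E.NoSinks) (A : Set (E.Path n)) :
    rangeSum A =
      ∑ e, lam u hU (S E e) * rangeSum (σ.preimage e A) * star (lam u hU (S E e)) := by
  classical
  rw [← mul_one (rangeSum A), ← hsink.sum_SPath (n + 1), ← Equiv.sum_comp σ.toPerm, Finset.mul_sum,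
    sum_path_succ _ (fun e α => lam u hU (S E e) *
      (if α ∈ σ.preimage e A then E.SPath α * star (E.SPath α) else 0) * star (lam u hU (S E e)))]
  · refine Finset.sum_congr rfl fun e _ => ?_
    rw [rangeSum, Finset.mul_sum, Finset.sum_mul]
  · intro e α hα
    have h1 : rangeSum A * E.SPath (σ.toPerm (α.cons e hα)) =
        if α ∈ σ.preimage e A then E.SPath (σ.toPerm (α.cons e hα)) else 0 := by
      have h2 : α ∈ σ.preimage e A ↔ (σ.toPerm (α.cons e hα)).init ∈ A :=
        ⟨fun h => h.2, fun h => ⟨hα, h⟩⟩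
      simp only [h2]
      rw [SPath_eq_init_last, ← mul_assoc, rangeSum_mul_SPath]
      split_ifs <;> simp
    rw [← mul_assoc, h1]
    split_ifs
    · rw [← h.lam_S_mul_SPath hU e α hα, star_mul]
      simp only [mul_assoc]
    · simp
  · intro e α hα
    rw [if_neg fun h => hα h.1]
    simp

theorem rangeSum_eq_of_src {n : ℕ} (hsink : E.NoSinks) {A : Set (E.Path n)}
    (hA : ∀ α β : E.Path n, α.src = β.src → α ∈ A → β ∈ A) {u : E.CStar} (hU : u ∈ E.UE) :
    IsLamCore u hU (rangeSum A) := by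
  classical
  have hP : ∀ v, P E v = ∑ α : E.Path n, if α.src = v then E.SPath α * star (E.SPath α) else 0 := by
    intro v
    rw [← mul_one (P E v), ← hsink.sum_SPath n, Finset.mul_sum]
    refine Finset.sum_congr rfl fun α _ => ?_
    rw [← mul_assoc]
    split_ifs with h
    · rw [← h, P_mul_SPath]
    · rw [P_mul_SPath_ne (Ne.symm h), zero_mul]
  have h1 : rangeSum A = ∑ v, if ∃ β ∈ A, β.src = v then P E v else 0 := by
    have h2 : ∀ v, (if ∃ β ∈ A, β.src = v then P E v else 0) = ∑ α : E.Path n,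
        if α.src = v then (if α ∈ A then E.SPath α * star (E.SPath α) else 0) else 0 := by
      intro v
      split_ifs with h
      · obtain ⟨β, hβ, rfl⟩ := h
        rw [hP]
        refine Finset.sum_congr rfl fun α _ => ?_
        by_cases hα : α.src = β.src
        · rw [if_pos hα, if_pos hα, if_pos (hA _ _ hα.symm hβ)]
        · rw [if_neg hα, if_neg hα]
      · refine (Finset.sum_eq_zero fun α _ => ?_).symm
        split_ifs with h3 h4
        · exact absurd ⟨α, h4, h3⟩ h
        · rfl
        · rfl
    simp only [h2]
    rw [Finset.sum_comm]
    simp [rangeSum]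
  rw [h1]
  refine IsLamCore.sum fun v _ => ?_
  split_ifs
  · exact ⟨P E v, .vertex v, lam_P u hU v⟩
  · exact ⟨0, .zero, map_zero _⟩

theorem PathPerm.Represents.isLamCore_rangeSum {n : ℕ} {σ : E.PathPerm (n + 1)} {u : E.CStar}
    (h : σ.Represents u) (hU : u ∈ E.UE) (hsink : E.NoSinks) (hσ : σ.DiagonalOrderCondition)
    (A : Set (E.Path n)) : IsLamCore u hU (rangeSum A) := by
  obtain ⟨o, -, hlt⟩ := hσ
  have hrank : ∀ p q : PathPerm.SrcPairs E n, p < q →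
      {x | q < x}.ncard < {x | p < x}.ncard := fun p q hpq =>
    Set.ncard_lt_ncard ⟨fun x hx => hpq.trans hx, fun hsub => lt_irrefl q (hsub hpq)⟩
      (Set.toFinite _)
  suffices H : ∀ (m : ℕ) (A : Set (E.Path n)), (∀ p : PathPerm.SrcPairs E n, p.1.1 ∈ A →
      p.1.2 ∉ A → {x | p < x}.ncard < m) → IsLamCore u hU (rangeSum A) by
    refine H ((Set.univ : Set (PathPerm.SrcPairs E n)).ncard + 1) A fun p _ _ => ?_
    exact Nat.lt_succ_of_le (Set.ncard_le_ncard (Set.subset_univ _) (Set.toFinite _))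
  intro m
  induction m with
  | zero =>
    intro A hA
    refine rangeSum_eq_of_src hsink (fun α β hαβ hα => ?_) hU
    by_contra hβ
    exact absurd (hA ⟨(α, β), hαβ⟩ hα hβ) (Nat.not_lt_zero _)
  | succ m ih =>
    intro A hA
    rw [h.rangeSum_eq hU hsink]
    refine IsLamCore.sum fun e _ => (ih _ ?_).sandwich e e
    rintro ⟨⟨α, β⟩, hαβ⟩ ⟨hα, hαA⟩ hβ
    have hβ' : β.src = E.r e := hαβ.symm.trans hα
    have hβA : (σ.toPerm (β.cons e hβ')).init ∉ A := fun h' => hβ ⟨hβ', h'⟩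
    have hne : α ≠ β := by
      rintro rfl
      exact hβA hαA
    have h1 := hA (PathPerm.srcPair (σ.f e ⟨α, hα⟩) (σ.f e ⟨β, hβ'⟩)) hαA hβA
    have h2 := hrank _ _ (hlt e ⟨α, hα⟩ ⟨β, hβ'⟩ fun h' => hne (congrArg Subtype.val h'))
    exact lt_of_lt_of_le h2 (Nat.lt_succ_iff.1 h1)

theorem PathPerm.Represents.isLamCore_SPath {n : ℕ} {σ : E.PathPerm (n + 1)} {u : E.CStar}
    (h : σ.Represents u) (hU : u ∈ E.UE) (hsink : E.NoSinks) (h1 : σ.DiagonalOrderCondition)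
    (h2 : σ.OffDiagonalOrderCondition) (α β : E.Path n) :
    IsLamCore u hU (E.SPath α * star (E.SPath β)) := by
  classical
  have hdiag : ∀ α : E.Path n, IsLamCore u hU (E.SPath α * star (E.SPath α)) := fun α => by
    have := h.isLamCore_rangeSum hU hsink h1 {α}
    simpa [rangeSum] using this
  obtain ⟨o, -, hlt⟩ := h2
  have hoff : ∀ p : PathPerm.Psi E n, IsLamCore u hU (E.SPath p.1.1 * star (E.SPath p.1.2)) := by
    intro p
    induction p using WellFoundedGT.induction with
    | ind p ih =>
      have h3 : E.SPath p.1.1 * star (E.SPath p.1.2) =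
          ∑ k, (E.SPath p.1.1 * S E k) * star (E.SPath p.1.2 * S E k) := by
        conv_lhs => rw [← mul_one (E.SPath p.1.1), ← hsink.sum_S, Finset.mul_sum, Finset.sum_mul]
        refine Finset.sum_congr rfl fun k _ => ?_
        rw [star_mul]
        simp only [mul_assoc]
      rw [h3]
      refine IsLamCore.sum fun k _ => ?_
      by_cases hk : E.s k = p.1.1.rng
      · by_cases hk' : E.s k = p.1.2.rng
        · obtain ⟨μ, hμ, hμk⟩ := p.1.1.exists_snoc k hk
          obtain ⟨ν, hν, hνk⟩ := p.1.2.exists_snoc k hk'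
          obtain ⟨e, α, hα, hμα⟩ := (σ.toPerm.symm μ).exists_cons
          obtain ⟨g, β, hβ, hνβ⟩ := (σ.toPerm.symm ν).exists_cons
          rw [Equiv.symm_apply_eq] at hμα hνβ
          have h4 : E.SPath p.1.1 * S E k = lam u hU (S E e) * E.SPath α := by
            rw [h.lam_S_mul_SPath hU e α hα, ← hμα, SPath_eq_init_last, hμ, hμk]
          have h5 : E.SPath p.1.2 * S E k = lam u hU (S E g) * E.SPath β := by
            rw [h.lam_S_mul_SPath hU g β hβ, ← hνβ, SPath_eq_init_last, hν, hνk]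
          have h6 : IsLamCore u hU (E.SPath α * star (E.SPath β)) := by
            by_cases hαβ : α = β
            · rw [hαβ]; exact hdiag β
            · refine ih ⟨(α, β), hαβ⟩ (hlt e g _ _ ⟨hα, hβ, ?_, ?_, ?_⟩)
              · rw [← hμα, hμ]
              · rw [← hνβ, hν]
              · rw [← hμα, ← hνβ, hμk, hνk]
          have h7 := h6.sandwich e g
          rw [h4, h5, star_mul]
          simpa only [mul_assoc] using h7
        · rw [SPath_mul_S_ne (Ne.symm hk'), star_zero, mul_zero]
          exact ⟨0, .zero, map_zero _⟩
      · rw [SPath_mul_S_ne (Ne.symm hk), zero_mul]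
        exact ⟨0, .zero, map_zero _⟩
  by_cases hαβ : α = β
  · rw [hαβ]; exact hdiag β
  · exact hoff ⟨(α, β), hαβ⟩

theorem PathPerm.Represents.isLamCore_SPath_succ {n : ℕ} {σ : E.PathPerm (n + 1)} {u : E.CStar}
    (h : σ.Represents u) (hU : u ∈ E.UE)
    (hcore : ∀ α β : E.Path n, IsLamCore u hU (E.SPath α * star (E.SPath β)))
    (μ ν : E.Path (n + 1)) : IsLamCore u hU (E.SPath μ * star (E.SPath ν)) := by
  obtain ⟨e, α, hα, hμ⟩ := (σ.toPerm.symm μ).exists_cons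
  obtain ⟨g, β, hβ, hν⟩ := (σ.toPerm.symm ν).exists_cons
  rw [Equiv.symm_apply_eq] at hμ hν
  have h1 := (hcore α β).sandwich e g
  rw [hμ, hν, ← h.lam_S_mul_SPath hU e α hα, ← h.lam_S_mul_SPath hU g β hβ, star_mul]
  simpa only [mul_assoc] using h1

theorem PathPerm.Represents.lam_bijective {n : ℕ} {σ : E.PathPerm (n + 1)} {u : E.CStar}
    (h : σ.Represents u) (hU : u ∈ E.UE) (hsink : E.NoSinks) (h1 : σ.DiagonalOrderCondition)
    (h2 : σ.OffDiagonalOrderCondition) : Function.Bijective (lam u hU) := by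
  have hu : IsCore u := by
    rw [h]
    exact IsCore.sum fun μ _ => isCore_SPath _ _
  have hs : IsLamCore u hU (star u) := by
    have h3 : star u = ∑ μ, E.SPath μ * star (E.SPath (σ.toPerm μ)) := by
      conv_lhs => rw [h]
      simp only [star_sum, star_mul, star_star]
    rw [h3]
    exact IsLamCore.sum fun μ _ =>
      h.isLamCore_SPath_succ hU (h.isLamCore_SPath hU hsink h1 h2) _ _
  obtain ⟨w, hw, hwu⟩ := hs
  exact hu.lam_bijective hsink hU hw hwu

end DirGraph

end

theorem theorem6p4 {V Ed : Type*} [Fintype V] [Fintype Ed] (E : DirGraph V Ed)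
    (hsink : E.NoSinks) (hexit : E.EveryLoopHasExit) (n : ℕ) (u : E.CStar)
    (hP : u ∈ E.PE (n + 1)) (hU : u ∈ E.UE) :
    (∃! σ : E.PathPerm (n + 1), σ.Represents u) ∧
    ∀ σ : E.PathPerm (n + 1), σ.Represents u →
      (Function.Bijective (DirGraph.lam u hU) ↔
        σ.DiagonalOrderCondition ∧ σ.OffDiagonalOrderCondition) :=
  ⟨DirGraph.existsUnique_represents hsink hP hU, fun _ hσ =>
    ⟨fun hb => ⟨hσ.diagonalOrderCondition hU hsink hb.2,
      hσ.offDiagonalOrderCondition hU hsink hb.2⟩,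
    fun h => hσ.lam_bijective hU hsink h.1 h.2⟩⟩
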